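/- Let $(M,g,J)$ be a compact Kähler manifold (without boundary), i.e. a compact smooth Riemannian manifold $(M,g)$ with a smooth $g$-orthogonal almost complex structure $J$ ($J^2=-\mathrm{id}$) which is parallel with respect to the Levi-Civita connection of $g$. A Weyl connection on $(M,g)$ is a torsion-free linear connection $D$ on $\mathrm{T}M$ satisfying $Dg=-2\theta\otimes g$ for some smooth $1$-form $\theta$, called the Lee form of $D$ with respect to $g$. A conformal product structure of rank $r\ge 1$ on $(M,g)$ is a Weyl connection $D$ together with a $g$-orthogonal direct sum decomposition $\mathrm{T}M=T_1\oplus T_2$ into $D$-parallel smooth distributions of constant rank with $\dim(T_1)\ge\dim(T_2)=r$. Then every conformal product structure on $(M,g)$ whose Lee form with respect to $g$ is not identically zero has rank $1$, i.e. $\dim(T_2)=1$. -/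

import Mathlib

open Bundle Topology
open scoped Manifold ContDiff

/-- A smooth Riemannian metric on an `n`-dimensional manifold (without boundary). -/
abbrev SmoothMetric (n : ℕ) (M : Type*) [TopologicalSpace M]
    [ChartedSpace (EuclideanSpace ℝ (Fin n)) M] [IsManifold (𝓡 n) ∞ M] :=
  ContMDiffRiemannianMetric (𝓡 n) ∞ (EuclideanSpace ℝ (Fin n))
    (fun x : M ↦ TangentSpace (𝓡 n) x)

/-- A linear connection `D` on the tangent bundle; `D Y x v` is `(D_v Y)(x)`. -/
abbrev AffineConnection (n : ℕ) (M : Type*) [TopologicalSpace M]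
    [ChartedSpace (EuclideanSpace ℝ (Fin n)) M] [IsManifold (𝓡 n) ∞ M] :=
  CovariantDerivative (𝓡 n) (EuclideanSpace ℝ (Fin n)) (fun x : M ↦ TangentSpace (𝓡 n) x)

section

variable {n : ℕ} {M : Type*} [TopologicalSpace M]
  [ChartedSpace (EuclideanSpace ℝ (Fin n)) M] [IsManifold (𝓡 n) ∞ M]

/-- The vector field `Y` is differentiable at `x`. -/
abbrev DiffVectorFieldAt (Y : Π y : M, TangentSpace (𝓡 n) y) (x : M) : Prop :=
  MDifferentiableAt (𝓡 n) ((𝓡 n).prod 𝓘(ℝ, EuclideanSpace ℝ (Fin n)))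
    (fun y ↦ TotalSpace.mk' (EuclideanSpace ℝ (Fin n))
      (E := fun x : M ↦ TangentSpace (𝓡 n) x) y (Y y)) x

/-- The vector field `Y` is smooth on `U`. -/
abbrev SmoothVectorFieldOn (Y : Π y : M, TangentSpace (𝓡 n) y) (U : Set M) : Prop :=
  ContMDiffOn (𝓡 n) ((𝓡 n).prod 𝓘(ℝ, EuclideanSpace ℝ (Fin n))) ∞
    (fun y ↦ TotalSpace.mk' (EuclideanSpace ℝ (Fin n))
      (E := fun x : M ↦ TangentSpace (𝓡 n) x) y (Y y)) U

/-- `D` is a smooth torsion-free connection with `D g = -2 θ ⊗ g`, where `θ` is a smooth `1`-form: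
a Weyl connection with Lee form `θ` with respect to `g`. The left-hand side of `derivMetric` is
`(D_v g)(Y, Z)` at the point `x`. -/
structure IsWeylConnection (g : SmoothMetric n M) (D : AffineConnection n M)
    (θ : Π x : M, TangentSpace (𝓡 n) x →L[ℝ] ℝ) : Prop where
  smooth : CovariantDerivative.ContMDiffCovariantDerivative D ∞
  torsionFree : D.torsion = 0
  leeForm_smooth : ContMDiff (𝓡 n) ((𝓡 n).prod 𝓘(ℝ, EuclideanSpace ℝ (Fin n) →L[ℝ] ℝ)) ∞
    (fun x ↦ TotalSpace.mk' (EuclideanSpace ℝ (Fin n) →L[ℝ] ℝ)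
      (E := fun x : M ↦ TangentSpace (𝓡 n) x →L[ℝ] ℝ) x (θ x))
  derivMetric : ∀ (x : M) (Y Z : Π y : M, TangentSpace (𝓡 n) y),
    DiffVectorFieldAt Y x → DiffVectorFieldAt Z x → ∀ v : TangentSpace (𝓡 n) x,
      mvfderiv (𝓡 n) (fun y ↦ g.inner y (Y y) (Z y)) x v
          - g.inner x (D Y x v) (Z x) - g.inner x (Y x) (D Z x v)
        = -2 * θ x v * g.inner x (Y x) (Z x)

/-- `D` is the Levi-Civita connection of `g`: smooth, torsion-free and `D g = 0`. -/
structure IsLeviCivita (g : SmoothMetric n M) (D : AffineConnection n M) : Prop where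
  smooth : CovariantDerivative.ContMDiffCovariantDerivative D ∞
  torsionFree : D.torsion = 0
  derivMetric : ∀ (x : M) (Y Z : Π y : M, TangentSpace (𝓡 n) y),
    DiffVectorFieldAt Y x → DiffVectorFieldAt Z x → ∀ v : TangentSpace (𝓡 n) x,
      mvfderiv (𝓡 n) (fun y ↦ g.inner y (Y y) (Z y)) x v
          - g.inner x (D Y x v) (Z x) - g.inner x (Y x) (D Z x v) = 0

/-- `(M, g, J)` is Kähler: `J` is a smooth `g`-orthogonal almost complex structure that is parallel
for the Levi-Civita connection of `g`. -/
structure IsKahler (g : SmoothMetric n M)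
    (J : Π x : M, TangentSpace (𝓡 n) x →L[ℝ] TangentSpace (𝓡 n) x) : Prop where
  smooth : ContMDiff (𝓡 n)
    ((𝓡 n).prod 𝓘(ℝ, EuclideanSpace ℝ (Fin n) →L[ℝ] EuclideanSpace ℝ (Fin n))) ∞
    (fun x ↦ TotalSpace.mk' (EuclideanSpace ℝ (Fin n) →L[ℝ] EuclideanSpace ℝ (Fin n))
      (E := fun x : M ↦ TangentSpace (𝓡 n) x →L[ℝ] TangentSpace (𝓡 n) x) x (J x))
  sq : ∀ (x : M) (v : TangentSpace (𝓡 n) x), J x (J x v) = -v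
  orthogonal : ∀ (x : M) (v w : TangentSpace (𝓡 n) x),
    g.inner x (J x v) (J x w) = g.inner x v w
  parallel : ∃ D : AffineConnection n M, IsLeviCivita g D ∧
    ∀ (x : M) (Y : Π y : M, TangentSpace (𝓡 n) y), DiffVectorFieldAt Y x →
      ∀ v : TangentSpace (𝓡 n) x, D (fun y ↦ J y (Y y)) x v = J x (D Y x v)

/-- `T` is a smooth distribution (subbundle of the tangent bundle) of rank `k`: near every point
it has a smooth local frame with `k` elements. -/
def IsSmoothDistribution (T : Π x : M, Submodule ℝ (TangentSpace (𝓡 n) x)) (k : ℕ) : Prop :=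
  ∀ x : M, ∃ U : Set M, IsOpen U ∧ x ∈ U ∧ ∃ X : Fin k → Π y : M, TangentSpace (𝓡 n) y,
    (∀ i, SmoothVectorFieldOn (X i) U) ∧
    ∀ y ∈ U, LinearIndependent ℝ (fun i ↦ X i y) ∧
      Submodule.span ℝ (Set.range fun i ↦ X i y) = T y

/-- The distribution `T` is `D`-parallel: `D_v Y` lies in `T` for all local sections `Y` of `T`. -/
def IsParallelDistribution (D : AffineConnection n M)
    (T : Π x : M, Submodule ℝ (TangentSpace (𝓡 n) x)) : Prop :=
  ∀ (x : M) (Y : Π y : M, TangentSpace (𝓡 n) y), DiffVectorFieldAt Y x → (∀ᶠ y in 𝓝 x, Y y ∈ T y) →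
    ∀ v : TangentSpace (𝓡 n) x, D Y x v ∈ T x

/-- A conformal product structure on `(M, g)`: a Weyl connection `D` (with its Lee form) and an
orthogonal `D`-parallel decomposition `TM = T₁ ⊕ T₂` with `dim T₁ ≥ dim T₂ = rank ≥ 1`. -/
structure ConformalProductStructure (g : SmoothMetric n M) where
  D : AffineConnection n M
  leeForm : Π x : M, TangentSpace (𝓡 n) x →L[ℝ] ℝ
  isWeyl : IsWeylConnection g D leeForm
  T₁ : Π x : M, Submodule ℝ (TangentSpace (𝓡 n) x)
  T₂ : Π x : M, Submodule ℝ (TangentSpace (𝓡 n) x)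
  corank : ℕ
  rank : ℕ
  isSmooth₁ : IsSmoothDistribution T₁ corank
  isSmooth₂ : IsSmoothDistribution T₂ rank
  isCompl : ∀ x : M, IsCompl (T₁ x) (T₂ x)
  orthogonal : ∀ x : M, ∀ v ∈ T₁ x, ∀ w ∈ T₂ x, g.inner x v w = 0
  parallel₁ : IsParallelDistribution D T₁
  parallel₂ : IsParallelDistribution D T₂
  one_le_rank : 1 ≤ rank
  rank_le_corank : rank ≤ corank

end

/-! Suppose both ranks n₁ = dim T₁ and n₂ = dim T₂ are at least 2. Let ∇ be the Levi-Civita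
connection, R its curvature, Θ the vector field dual to the Lee form θ, and Θ = Θ₁ + Θ₂ its
splitting. The aim is a vector field whose divergence is minus a positive definite form in (Θ₁, Θ₂);
integrating over the compact manifold then forces θ = 0.

Since D preserves T₁, its curvature sends T₁ to itself. Writing D as ∇ plus the tensor built from Θ
turns this into a formula for g(R(u,v)a,b) with a in T₁ and b in T₂: it is of Kulkarni-Nomizu type
in H = ∇Θ - θ ⊗ Θ + ½|θ|² (`curvature_mixed`). The Kähler condition gives g(R(x,y)x,y) =
g(R(x,y)Jx,Jy). For x in T₁, y in T₂ and Jx ⊥ y, splitting Jx and Jy along T₁ ⊕ T₂ shows that the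
right-hand side vanishes, so g(Hx,x)|y|² + g(Hy,y)|x|² = 0 (`mixed_curvature_eq_zero`).

A singular value decomposition of the T₂-component of J on T₁ gives orthonormal bases for which Jx ⊥
y can fail only along a partial matching. Because both bases have at least two elements, the
exceptional pairs do not spoil the sum over all pairs, and n₂ tr(H on T₁) + n₁ tr(H on T₂) = 0
(`trace_projection_add_eq_zero`), the traces being those of the compressions of H. Rewritten with ∇,
this is div(n₁Θ₂ + n₂Θ₁) = -(n₂(n₂-1)|Θ₁|² + n₁(n₁-1)|Θ₂|²) (`christoffelDiv_leeCombination`).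

The curvature computation takes place in charts, where connections are Christoffel symbols. The
divergence theorem (`eq_zero_of_divergence_nonpos`) glues integrals over charts by a partition of
unity, without a global Riemannian measure. -/

set_option maxSynthPendingDepth 3

/-! ### Pointwise linear algebra: adapted bases, traces and curvature symmetries -/

section Algebra

open Module

/-- If `α a + β i = 0` off a partial matching, then the sum over all pairs vanishes. -/
lemma sum_eq_zero_of_partial_matching {ι κ : Type*} [Fintype ι] [Fintype κ]
    (hι : 2 ≤ Fintype.card ι) (hκ : 2 ≤ Fintype.card κ) (r : ι → κ → Prop)
    (hr₁ : ∀ a b i, r a i → r b i → a = b) (hr₂ : ∀ a i j, r a i → r a j → i = j)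
    (α : ι → ℝ) (β : κ → ℝ) (h : ∀ a i, ¬ r a i → α a + β i = 0) :
    (Fintype.card κ : ℝ) * ∑ a, α a + (Fintype.card ι : ℝ) * ∑ i, β i = 0 := by
  classical
  -- In the 2×2 square with rows a, b and columns i, j, an entry of one diagonal shares a row or a
  -- column with each entry of the other. Hence `r` meets at most one diagonal, and the hypothesis
  -- can be added up along the other one.
  have key : ∀ a b i j, a ≠ b → i ≠ j → α a + β i + (α b + β j) = 0 := by
    intro a b i j hab hij
    by_cases h1 : r a i
    · have h2 := h a j fun h' => hij (hr₂ _ _ _ h1 h')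
      have h3 := h b i fun h' => hab (hr₁ _ _ _ h1 h')
      linarith
    · by_cases h2 : r b j
      · have h3 := h a j fun h' => hab (hr₁ _ _ _ h' h2)
        have h4 := h b i fun h' => hij (hr₂ _ _ _ h' h2)
        linarith
      · have h3 := h a i h1
        have h4 := h b j h2
        linarith
  -- The 0-1 weights encode a ≠ b and i ≠ j, so that the square identities can be summed over all
  -- quadruples.
  have key2 : ∀ a b i j, (if a = b then (0 : ℝ) else 1) * (if i = j then (0 : ℝ) else 1) *
      (α a + β i + (α b + β j)) = 0 := by
    intro a b i j
    by_cases hab : a = b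
    · simp [hab]
    · by_cases hij : i = j
      · simp [hij]
      · simp [key a b i j hab hij]
  have e1 : ∀ a : ι, ∑ b, (if a = b then (0 : ℝ) else 1) = Fintype.card ι - 1 := by
    intro a
    have : ∀ b, (if a = b then (0 : ℝ) else 1) = 1 - if a = b then 1 else 0 := by
      intro b; split_ifs <;> simp
    simp [this, Finset.sum_sub_distrib]
  have e2 : ∀ i : κ, ∑ j, (if i = j then (0 : ℝ) else 1) = Fintype.card κ - 1 := by
    intro a
    have : ∀ b, (if a = b then (0 : ℝ) else 1) = 1 - if a = b then 1 else 0 := by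
      intro b; split_ifs <;> simp
    simp [this, Finset.sum_sub_distrib]
  set N : ℝ := (Fintype.card ι : ℝ) with hN
  set K : ℝ := (Fintype.card κ : ℝ) with hK
  have hN2 : (2 : ℝ) ≤ N := by rw [hN]; exact_mod_cast hι
  have hK2 : (2 : ℝ) ≤ K := by rw [hK]; exact_mod_cast hκ
  have e3 : ∑ a, ∑ i, ∑ b, ∑ j, (if a = b then (0 : ℝ) else 1) * (if i = j then (0 : ℝ) else 1) *
      (α a + β i) = (N - 1) * (K - 1) * (K * ∑ a, α a + N * ∑ i, β i) := by
    have : ∀ a i, ∑ b, ∑ j, (if a = b then (0 : ℝ) else 1) * (if i = j then (0 : ℝ) else 1) *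
      (α a + β i) = (N - 1) * (K - 1) * (α a + β i) := by
      intro a i
      rw [← e1 a, ← e2 i, Finset.sum_mul_sum, Finset.sum_mul]
      simp_rw [Finset.sum_mul]
    simp_rw [this, ← Finset.mul_sum, Finset.sum_add_distrib]
    simp [Finset.mul_sum, hN, hK]
  have e4 : ∑ a, ∑ i, ∑ b, ∑ j, (if a = b then (0 : ℝ) else 1) * (if i = j then (0 : ℝ) else 1) *
      (α b + β j) = (N - 1) * (K - 1) * (K * ∑ a, α a + N * ∑ i, β i) := by
    rw [← e3]
    have : ∀ a : ι, ∑ i : κ, ∑ b : ι, ∑ j : κ, (if a = b then (0 : ℝ) else 1) *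
        (if i = j then (0 : ℝ) else 1) * (α b + β j) = ∑ b : ι, ∑ j : κ, ∑ i : κ,
          (if a = b then (0 : ℝ) else 1) * (if i = j then (0 : ℝ) else 1) * (α b + β j) := by
      intro a
      rw [Finset.sum_comm]
      exact Finset.sum_congr rfl fun b _ => Finset.sum_comm
    simp_rw [this]
    rw [Finset.sum_comm]
    refine Finset.sum_congr rfl fun b _ => ?_
    rw [Finset.sum_comm]
    refine Finset.sum_congr rfl fun j _ => Finset.sum_congr rfl fun a _ =>
      Finset.sum_congr rfl fun i _ => ?_
    simp only [eq_comm]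
  have e5 : 2 * ((N - 1) * (K - 1) * (K * ∑ a, α a + N * ∑ i, β i)) = 0 := by
    rw [two_mul]
    nth_rewrite 1 [← e3]
    rw [← e4]
    simp_rw [← Finset.sum_add_distrib, ← mul_add]
    refine Finset.sum_eq_zero fun a _ => Finset.sum_eq_zero fun i _ => Finset.sum_eq_zero fun b _ =>
      Finset.sum_eq_zero fun j _ => key2 a b i j
  -- Each entry lies on a diagonal of (N-1)(K-1) squares; this number can be cancelled only when
  -- both index sets have at least two elements.
  have h6 : 0 < (N - 1) * (K - 1) := by apply mul_pos <;> linarith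
  rcases mul_eq_zero.1 e5 with h | h
  · norm_num at h
  · exact (mul_eq_zero.1 h).resolve_left h6.ne'

open scoped InnerProductSpace in
/-- A linear map between Euclidean spaces admits adapted orthonormal bases: each vector of one
basis is non-orthogonal to the image of at most one vector of the other one, and conversely. -/
lemma exists_orthonormalBasis_matching {V W : Type*} [NormedAddCommGroup V]
    [InnerProductSpace ℝ V] [FiniteDimensional ℝ V] [NormedAddCommGroup W] [InnerProductSpace ℝ W]
    [FiniteDimensional ℝ W] (B : V →ₗ[ℝ] W) :
    ∃ (u : Finset W) (e : OrthonormalBasis (Fin (finrank ℝ V)) ℝ V) (f : OrthonormalBasis u ℝ W),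
      (∀ a b i, ⟪B (e a), f i⟫_ℝ ≠ 0 → ⟪B (e b), f i⟫_ℝ ≠ 0 → a = b) ∧
      (∀ a i j, ⟪B (e a), f i⟫_ℝ ≠ 0 → ⟪B (e a), f j⟫_ℝ ≠ 0 → i = j) := by
  classical
  -- Singular value decomposition: eigenvectors of B*B have mutually orthogonal images under B.
  have hsym : (B.adjoint ∘ₗ B).IsSymmetric := by
    intro x y
    simp [LinearMap.adjoint_inner_left, LinearMap.adjoint_inner_right]
  set e := hsym.eigenvectorBasis rfl with he
  have hBe : ∀ a b, a ≠ b → ⟪B (e a), B (e b)⟫_ℝ = 0 := by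
    intro a b hab
    have h1 : ⟪(B.adjoint ∘ₗ B) (e a), e b⟫_ℝ = ⟪B (e a), B (e b)⟫_ℝ := by
      simp [LinearMap.adjoint_inner_left]
    rw [← h1, he, hsym.apply_eigenvectorBasis, ← he, real_inner_smul_left]
    simp [e.orthonormal.2 hab]
  -- Only the nonzero images are normalised. The basis vectors added afterwards are orthogonal to
  -- the whole image of B, hence never matched.
  set s : Set W := {w | ∃ a, B (e a) ≠ 0 ∧ w = ‖B (e a)‖⁻¹ • B (e a)} with hs
  have hso : Orthonormal ℝ ((↑) : s → W) := by
    constructor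
    · rintro ⟨w, a, ha, rfl⟩
      simp [norm_smul, ha]
    · rintro ⟨w, a, ha, rfl⟩ ⟨w', b, hb, rfl⟩ hne
      have hab : a ≠ b := by rintro rfl; exact hne rfl
      simp [real_inner_smul_left, real_inner_smul_right, hBe a b hab]
  obtain ⟨u, f, hsu, hf⟩ := hso.exists_orthonormalBasis_extension
  have hmem : ∀ a (ha : B (e a) ≠ 0), ∃ k : u, f k = ‖B (e a)‖⁻¹ • B (e a) := by
    intro a ha
    have : ‖B (e a)‖⁻¹ • B (e a) ∈ u := by
      have := hsu (show ‖B (e a)‖⁻¹ • B (e a) ∈ s from ⟨a, ha, rfl⟩)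
      simpa using this
    exact ⟨⟨_, this⟩, by rw [hf]⟩
  have hk : ∀ a i, ⟪B (e a), f i⟫_ℝ ≠ 0 → f i = ‖B (e a)‖⁻¹ • B (e a) := by
    intro a i hai
    have ha : B (e a) ≠ 0 := by rintro h; simp [h] at hai
    obtain ⟨k, hk⟩ := hmem a ha
    have hki : k = i := by
      by_contra hne
      have h0 : ⟪f k, f i⟫_ℝ = 0 := f.orthonormal.2 hne
      rw [hk, real_inner_smul_left] at h0
      rcases mul_eq_zero.1 h0 with h | h
      · simp [ha] at h
      · exact hai h
    rw [← hki, hk]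
  refine ⟨u, e, f, ?_, ?_⟩
  · intro a b i ha hb
    by_contra hab
    have h1 := hk a i ha
    rw [h1, real_inner_smul_right, hBe b a (Ne.symm hab), mul_zero] at hb
    exact hb rfl
  · intro a i j hi hj
    have h1 := hk a i hi
    have h2 := hk a j hj
    exact f.toBasis.injective (by simp [h1, h2])

-- In the bases adapted to B the hypothesis holds at every pair off a partial matching, so the
-- combinatorial lemma applies to the diagonal entries of H and K.
open scoped InnerProductSpace in
lemma trace_add_trace_eq_zero_of_inner {V W : Type*} [NormedAddCommGroup V]
    [InnerProductSpace ℝ V] [FiniteDimensional ℝ V] [NormedAddCommGroup W] [InnerProductSpace ℝ W]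
    [FiniteDimensional ℝ W] (hV : 2 ≤ finrank ℝ V) (hW : 2 ≤ finrank ℝ W)
    (B : V →ₗ[ℝ] W) (H : V →ₗ[ℝ] V) (K : W →ₗ[ℝ] W)
    (h : ∀ x y, ⟪B x, y⟫_ℝ = 0 → ⟪x, H x⟫_ℝ * ⟪y, y⟫_ℝ + ⟪y, K y⟫_ℝ * ⟪x, x⟫_ℝ = 0) :
    (finrank ℝ W : ℝ) * LinearMap.trace ℝ V H + (finrank ℝ V : ℝ) * LinearMap.trace ℝ W K = 0 := by
  obtain ⟨u, e, f, h1, h2⟩ := exists_orthonormalBasis_matching B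
  rw [LinearMap.trace_eq_sum_inner H e, LinearMap.trace_eq_sum_inner K f]
  have c1 : Fintype.card (Fin (finrank ℝ V)) = finrank ℝ V := by simp
  have c2 : Fintype.card u = finrank ℝ W := (Module.finrank_eq_card_basis f.toBasis).symm
  have := sum_eq_zero_of_partial_matching (by rw [c1]; exact hV) (by rw [c2]; exact hW)
    (fun a i => ⟪B (e a), f i⟫_ℝ ≠ 0) h1 h2 (fun a => ⟪e a, H (e a)⟫_ℝ) (fun i => ⟪f i, K (f i)⟫_ℝ)
    (by
      intro a i hai
      have := h (e a) (f i) (not_not.1 hai)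
      simpa using this)
  rw [c1, c2] at this
  exact this

/-- Trace identity for a projection `P` that is orthogonal for the positive definite form `g`. -/
lemma trace_projection_add_eq_zero {V : Type*} [AddCommGroup V] [Module ℝ V]
    [FiniteDimensional ℝ V] (g : V →ₗ[ℝ] V →ₗ[ℝ] ℝ) (hgs : ∀ v w, g v w = g w v)
    (hgp : ∀ v, v ≠ 0 → 0 < g v v) (P J H : V →ₗ[ℝ] V) (hP : ∀ v, P (P v) = P v)
    (hPs : ∀ v w, g (P v) w = g v (P w)) {n₁ n₂ : ℕ} (hn₁ : finrank ℝ (LinearMap.range P) = n₁)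
    (hn₂ : finrank ℝ (LinearMap.ker P) = n₂) (h₁ : 2 ≤ n₁) (h₂ : 2 ≤ n₂)
    (h : ∀ x y, P x = x → P y = 0 → g (J x) y = 0 → g (H x) x * g y y + g (H y) y * g x x = 0) :
    (n₂ : ℝ) * LinearMap.trace ℝ V (P ∘ₗ H) + (n₁ : ℝ) * LinearMap.trace ℝ V (H - P ∘ₗ H) = 0 := by
  -- The form g becomes the inner product of V, so that orthonormal bases of the range and kernel of
  -- P are meant with respect to g.
  let c : InnerProductSpace.Core ℝ V :=
    { inner := fun v w => g v w
      conj_inner_symm := fun v w => by simp [hgs v w]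
      re_inner_nonneg := fun v => by
        by_cases hv : v = 0
        · simp [hv]
        · exact (hgp v hv).le
      add_left := fun u v w => by simp
      smul_left := fun u v r => by simp
      definite := fun v hv => by
        by_contra hne
        exact (hgp v hne).ne' hv }
  let _ : NormedAddCommGroup V := c.toNormedAddCommGroup
  let _ : InnerProductSpace ℝ V := InnerProductSpace.ofCore c.toCore
  set Q : V →ₗ[ℝ] V := LinearMap.id - P with hQ
  have hQm : ∀ v, Q v ∈ LinearMap.ker P := fun v => by simp [hQ, hP]
  have hPr : ∀ v ∈ LinearMap.range P, P v = v := by rintro _ ⟨v, rfl⟩; exact hP v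
  let p : V →ₗ[ℝ] LinearMap.range P := P.rangeRestrict
  let q : V →ₗ[ℝ] LinearMap.ker P := Q.codRestrict _ hQm
  -- The map to be diagonalised is the kernel component of J on the range of P: its pairing with y
  -- in the kernel is g(Jx, y). The other two maps are the compressions of H.
  have key := trace_add_trace_eq_zero_of_inner (V := LinearMap.range P) (W := LinearMap.ker P)
    (by rw [hn₁]; exact h₁) (by rw [hn₂]; exact h₂)
    (q ∘ₗ J ∘ₗ (LinearMap.range P).subtype) (p ∘ₗ H ∘ₗ (LinearMap.range P).subtype)
    (q ∘ₗ H ∘ₗ (LinearMap.ker P).subtype) (by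
      rintro ⟨x, hx⟩ ⟨y, hy⟩ hxy
      have hPx := hPr x hx
      have hPy : P y = 0 := hy
      have hQg : ∀ v, g (Q v) y = g v y := fun v => by
        simp [hQ, hPs, hPy]
      have hxy' : g (Q (J x)) y = 0 := hxy
      rw [hQg] at hxy'
      have := h x y hPx hPy hxy'
      change g x (P (H x)) * g y y + g y (Q (H y)) * g x x = 0
      rw [← hPs, hPx, hgs x, hgs y (Q (H y)), hQg]
      exact this)
  rw [hn₁, hn₂] at key
  -- Cyclicity of the trace identifies the trace of PH on V with that of the compression of H.
  have t1 : LinearMap.trace ℝ V (P ∘ₗ H) =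
      LinearMap.trace ℝ _ (p ∘ₗ H ∘ₗ (LinearMap.range P).subtype) := by
    have : P ∘ₗ H = (LinearMap.range P).subtype ∘ₗ (p ∘ₗ H) := by ext v; rfl
    rw [this, LinearMap.trace_comp_comm', LinearMap.comp_assoc]
  have t2 : LinearMap.trace ℝ V (H - P ∘ₗ H) =
      LinearMap.trace ℝ _ (q ∘ₗ H ∘ₗ (LinearMap.ker P).subtype) := by
    have : H - P ∘ₗ H = (LinearMap.ker P).subtype ∘ₗ (q ∘ₗ H) := by ext v; simp [q, hQ]
    rw [this, LinearMap.trace_comp_comm', LinearMap.comp_assoc]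
  rw [t1, t2]
  exact key

/-- The pair symmetry of algebraic curvature tensors. -/
lemma curvature_pair_symm {V : Type*} [AddCommGroup V] [Module ℝ V]
    (g : V →ₗ[ℝ] V →ₗ[ℝ] ℝ) (R : V → V → V → V)
    (h12 : ∀ u v a, R u v a = - R v u a) (h34 : ∀ u v a b, g (R u v a) b = - g (R u v b) a)
    (hB : ∀ u v a, R u v a + R v a u + R a u v = 0) (u v a b : V) :
    g (R u v a) b = g (R a b u) v := by
  have B : ∀ u v a b, g (R u v a) b + g (R v a u) b + g (R a u v) b = 0 := by
    intro u v a b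
    rw [← LinearMap.add_apply, ← map_add, ← LinearMap.add_apply, ← map_add, hB]
    simp
  have s12 : ∀ u v a b, g (R u v a) b = - g (R v u a) b := by
    intro u v a b
    rw [h12]; simp
  -- Milnor's octahedron argument: four instances of the Bianchi identity combined with the two
  -- skew-symmetries.
  have b1 := B u v a b
  have b2 := B v a b u
  have b3 := B a b u v
  have b4 := B b u v a
  linarith [h34 u v a b, h34 v a u b, h34 a u v b, h34 v a b u, h34 a b v u, h34 b v a u,
    h34 a b u v, h34 b u a v, h34 u a b v, h34 b u v a, h34 u v b a, h34 v b u a,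
    s12 u v a b, s12 v a u b, s12 a u v b, s12 a b v u, s12 b v a u, s12 b u a v, s12 u v b a,
    s12 v b u a, s12 u a b v, s12 a b u v, s12 v a b u, s12 b u v a]

/-- Mixed sectional curvatures of a Kähler-type curvature tensor whose mixed part is of
Kulkarni-Nomizu type vanish on pairs of vectors spanning a totally real plane. -/
lemma mixed_curvature_eq_zero {V : Type*} [AddCommGroup V] [Module ℝ V]
    (g : V →ₗ[ℝ] V →ₗ[ℝ] ℝ) (hgs : ∀ v w, g v w = g w v) (P J : V →ₗ[ℝ] V)
    (hP : ∀ v, P (P v) = P v) (hPs : ∀ v w, g (P v) w = g v (P w))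
    (hJ : ∀ v, J (J v) = - v) (hJg : ∀ v w, g (J v) (J w) = g v w)
    (R : V → V → V →ₗ[ℝ] V) (h12 : ∀ u v a, R u v a = - R v u a)
    (h34 : ∀ u v a b, g (R u v a) b = - g (R u v b) a)
    (hB : ∀ u v a, R u v a + R v a u + R a u v = 0) (hRJ : ∀ u v a, R u v (J a) = J (R u v a))
    (H : V →ₗ[ℝ] V)
    (hmix : ∀ u v a b, P a = a → P b = 0 → g (R u v a) b =
      - (g (H u) a * g v b) + g (H u) b * g v a + g (H v) a * g u b - g (H v) b * g u a)
    (x y : V) (hx : P x = x) (hy : P y = 0) (hxy : g (J x) y = 0) :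
    g (H x) x * g y y + g (H y) y * g x x = 0 := by
  have pair := curvature_pair_symm g (fun u v a => R u v a) h12 h34 hB
  have hJs : ∀ v w, g (J v) w = - g v (J w) := by
    intro v w
    rw [← hJg v (J w), hJ]; simp
  have gxJx : g x (J x) = 0 := by have := hJs x x; rw [hgs] at this; linarith
  have gyJy : g y (J y) = 0 := by have := hJs y y; rw [hgs] at this; linarith
  have gxJy : g x (J y) = 0 := by have := hJs x y; linarith
  have gyJx : g y (J x) = 0 := by rw [hgs]; exact hxy
  have mixgen : ∀ a b, g x (P a) = g x a ∧ g y (P a) = 0 ∧ g x (b - P b) = 0 ∧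
      g y (b - P b) = g y b := by
    intro a b
    refine ⟨?_, ?_, ?_, ?_⟩
    · rw [← hPs, hx]
    · rw [← hPs, hy]; simp
    · rw [map_sub, ← hPs, hx]; simp
    · rw [map_sub, ← hPs, hy]; simp
  obtain ⟨a1, a2, a3, a4⟩ := mixgen (J x) (J x)
  obtain ⟨b1, b2, b3, b4⟩ := mixgen (J y) (J y)
  have hPk : ∀ b, P (b - P b) = 0 := fun b => by simp [hP]
  have gxy : g x y = 0 := by rw [← hx, hPs, hy]; simp
  -- The four blocks of g(R(x,y)Jx,Jy) along the splitting. The mixed blocks come directly from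
  -- `hmix`; in the pure blocks pair symmetry first moves x and y into the last two slots. Every
  -- term then contains one of g(x,Jx), g(y,Jy), g(x,Jy), g(y,Jx), all zero, so H need not be
  -- symmetric.
  have e1 : g (R x y (P (J x))) (P (J y)) = 0 := by
    rw [pair, hmix _ _ x y hx hy, hgs (P (J y)) y, hgs (P (J y)) x, hgs (P (J x)) y,
      hgs (P (J x)) x, a1, a2, b1, b2, gxJx, gxJy]
    ring
  have e2 : g (R x y (P (J x))) (J y - P (J y)) = 0 := by
    rw [hmix _ _ _ _ (hP _) (hPk _), a1, a2, b3, b4, gyJy, gxJx]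
    ring
  have e3 : g (R x y (J x - P (J x))) (P (J y)) = 0 := by
    rw [h34, hmix _ _ _ _ (hP _) (hPk _), b1, b2, a3, a4, gyJx, gxJy]
    ring
  have e4 : g (R x y (J x - P (J x))) (J y - P (J y)) = 0 := by
    rw [pair, hmix _ _ x y hx hy, hgs (J y - P (J y)) y, hgs (J y - P (J y)) x,
      hgs (J x - P (J x)) y, hgs (J x - P (J x)) x, a3, a4, b3, b4, gyJx, gyJy]
    ring
  have e5 : g (R x y (J x)) (J y) = 0 := by
    have h1 : R x y (J x) = R x y (P (J x)) + R x y (J x - P (J x)) := by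
      rw [← map_add]; congr 1; abel
    have h2 : ∀ w, g w (J y) = g w (P (J y)) + g w (J y - P (J y)) := by
      intro w; rw [← map_add]; congr 1; abel
    rw [h1, map_add, LinearMap.add_apply, h2, h2, e1, e2, e3, e4]
    simp
  -- J commutes with the curvature and is orthogonal, so the vanishing quantity is also
  -- g(R(x,y)x,y), which `hmix` evaluates.
  rw [hRJ, hJg, hmix _ _ x y hx hy, gxy, hgs y x, gxy] at e5
  linarith

end Algebra

/-! ### Curvature of a connection d + Γ and its symmetries -/

section Curvature

variable {E : Type*} [NormedAddCommGroup E] [NormedSpace ℝ E]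

/-- The curvature of the connection `d + Γ` on the trivial bundle over a vector space. -/
noncomputable def christoffelCurvature (Γ : E → E →L[ℝ] E →L[ℝ] E) (x u v : E) : E →L[ℝ] E :=
  fderiv ℝ Γ x u v - fderiv ℝ Γ x v u + (Γ x u ∘L Γ x v - Γ x v ∘L Γ x u)

lemma christoffelCurvature_apply (Γ : E → E →L[ℝ] E →L[ℝ] E) (x u v a : E) :
    christoffelCurvature Γ x u v a = fderiv ℝ Γ x u v a - fderiv ℝ Γ x v u a
      + (Γ x u (Γ x v a) - Γ x v (Γ x u a)) := rfl

lemma christoffelCurvature_swap (Γ : E → E →L[ℝ] E →L[ℝ] E) (x u v a : E) :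
    christoffelCurvature Γ x u v a = - christoffelCurvature Γ x v u a := by
  simp only [christoffelCurvature_apply]; abel

/-- The derivative of Γ inherits the symmetry of Γ, which is why symmetry is assumed near x and not
only at x; all terms of the cyclic sum then cancel in pairs. -/
lemma christoffelCurvature_bianchi {Γ : E → E →L[ℝ] E →L[ℝ] E} {x : E}
    (hΓ : DifferentiableAt ℝ Γ x) (hs : ∀ᶠ z in 𝓝 x, ∀ u v, Γ z u v = Γ z v u) (u v a : E) :
    christoffelCurvature Γ x u v a + christoffelCurvature Γ x v a u
      + christoffelCurvature Γ x a u v = 0 := by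
  have hd : ∀ w u v, fderiv ℝ Γ x w u v = fderiv ℝ Γ x w v u := by
    intro w u v
    have h1 : HasFDerivAt (fun z => Γ z u v) _ x :=
      ((hΓ.hasFDerivAt.clm_apply (hasFDerivAt_const u x)).clm_apply (hasFDerivAt_const v x))
    have h2 : HasFDerivAt (fun z => Γ z v u) _ x :=
      ((hΓ.hasFDerivAt.clm_apply (hasFDerivAt_const v x)).clm_apply (hasFDerivAt_const u x))
    have h3 := h1.unique (h2.congr_of_eventuallyEq (hs.mono fun z hz => hz u v))
    simpa using DFunLike.congr_fun h3 w
  have hs' := hs.self_of_nhds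
  simp only [christoffelCurvature_apply]
  rw [hd u v a, hd v a u, hd a u v, hs' v a, hs' u a, hs' u v]
  abel

/-- A parallel endomorphism commutes with the curvature. -/
lemma christoffelCurvature_comm {Γ : E → E →L[ℝ] E →L[ℝ] E} {K : E → E →L[ℝ] E} {x : E}
    (hΓ : DifferentiableAt ℝ Γ x) (hK : ContDiffAt ℝ 2 K x)
    (h : ∀ᶠ z in 𝓝 x, ∀ v a, fderiv ℝ K z v a = K z (Γ z v a) - Γ z v (K z a)) (u v a : E) :
    christoffelCurvature Γ x u v (K x a) = K x (christoffelCurvature Γ x u v a) := by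
  have hK1 : HasFDerivAt K (fderiv ℝ K x) x := (hK.differentiableAt (by norm_num)).hasFDerivAt
  have hK2 : HasFDerivAt (fderiv ℝ K) (fderiv ℝ (fderiv ℝ K) x) x :=
    ((hK.fderiv_right (m := 1) (by norm_num)).differentiableAt (by norm_num)).hasFDerivAt
  -- Ricci identity: differentiate the parallel equation once more, then antisymmetrise in u and v.
  -- The second derivatives of K drop out and the curvature commutator remains.
  have second : ∀ u v, fderiv ℝ (fderiv ℝ K) x u v a =
      fderiv ℝ K x u (Γ x v a) + K x (fderiv ℝ Γ x u v a)
        - fderiv ℝ Γ x u v (K x a) - Γ x v (fderiv ℝ K x u a) := by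
    intro u v
    have g1 : HasFDerivAt (fun z => Γ z v) _ x := hΓ.hasFDerivAt.clm_apply (hasFDerivAt_const v x)
    have h1 : HasFDerivAt (fun z => fderiv ℝ K z v a) _ x :=
      (hK2.clm_apply (hasFDerivAt_const v x)).clm_apply (hasFDerivAt_const a x)
    have h2 : HasFDerivAt (fun z => K z (Γ z v a) - Γ z v (K z a)) _ x :=
      (hK1.clm_apply (g1.clm_apply (hasFDerivAt_const a x))).sub
        (g1.clm_apply (hK1.clm_apply (hasFDerivAt_const a x)))
    have h3 := h1.unique (h2.congr_of_eventuallyEq (h.mono fun z hz => hz v a))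
    have h4 := DFunLike.congr_fun h3 u
    simp at h4
    rw [h4]; abel
  have hsym := (hK.isSymmSndFDerivAt (by simp)).eq u v
  have e := DFunLike.congr_fun hsym a
  rw [second u v, second v u] at e
  have h' := h.self_of_nhds
  simp only [h'] at e
  simp only [christoffelCurvature_apply, map_add, map_sub]
  rw [← sub_eq_zero] at e ⊢
  rw [← neg_eq_zero, ← e]
  simp only [map_sub]
  abel

/-- The curvature of a metric connection is skew-symmetric. -/
lemma christoffelCurvature_skew {Γ : E → E →L[ℝ] E →L[ℝ] E} {G : E → E →L[ℝ] E →L[ℝ] ℝ} {x : E}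
    (hΓ : DifferentiableAt ℝ Γ x) (hG : ContDiffAt ℝ 2 G x)
    (h : ∀ᶠ z in 𝓝 x, ∀ v a b, fderiv ℝ G z v a b = G z (Γ z v a) b + G z a (Γ z v b))
    (u v a b : E) :
    G x (christoffelCurvature Γ x u v a) b = - G x a (christoffelCurvature Γ x u v b) := by
  have hG1 : HasFDerivAt G (fderiv ℝ G x) x := (hG.differentiableAt (by norm_num)).hasFDerivAt
  have hG2 : HasFDerivAt (fderiv ℝ G) (fderiv ℝ (fderiv ℝ G) x) x :=
    ((hG.fderiv_right (m := 1) (by norm_num)).differentiableAt (by norm_num)).hasFDerivAt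
  -- The same argument with the parallel tensor G in place of an endomorphism.
  have second : ∀ u v, fderiv ℝ (fderiv ℝ G) x u v a b =
      fderiv ℝ G x u (Γ x v a) b + G x (fderiv ℝ Γ x u v a) b
        + fderiv ℝ G x u a (Γ x v b) + G x a (fderiv ℝ Γ x u v b) := by
    intro u v
    have g1 : HasFDerivAt (fun z => Γ z v) _ x := hΓ.hasFDerivAt.clm_apply (hasFDerivAt_const v x)
    have h1 : HasFDerivAt (fun z => fderiv ℝ G z v a b) _ x :=
      ((hG2.clm_apply (hasFDerivAt_const v x)).clm_apply (hasFDerivAt_const a x)).clm_apply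
        (hasFDerivAt_const b x)
    have h2 : HasFDerivAt (fun z => G z (Γ z v a) b + G z a (Γ z v b)) _ x :=
      ((hG1.clm_apply (g1.clm_apply (hasFDerivAt_const a x))).clm_apply (hasFDerivAt_const b x)).add
        ((hG1.clm_apply (hasFDerivAt_const a x)).clm_apply
          (g1.clm_apply (hasFDerivAt_const b x)))
    have h3 := h1.unique (h2.congr_of_eventuallyEq (h.mono fun z hz => hz v a b))
    have h4 := DFunLike.congr_fun h3 u
    simp at h4
    rw [h4]; ring
  have hsym := (hG.isSymmSndFDerivAt (by simp)).eq u v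
  have e := DFunLike.congr_fun (DFunLike.congr_fun hsym a) b
  rw [second u v, second v u] at e
  have h' := h.self_of_nhds
  simp only [h'] at e
  simp only [christoffelCurvature_apply, map_add, map_sub, add_apply, sub_apply]
  linarith

/-- The difference tensor of a Weyl connection with Lee field `Θ` and the Levi-Civita connection. -/
noncomputable def weylTensor (g : E →L[ℝ] E →L[ℝ] ℝ) (Θ : E) : E →L[ℝ] E →L[ℝ] E :=
  (g Θ).smulRight (ContinuousLinearMap.id ℝ E)
    + (ContinuousLinearMap.smulRightL ℝ E E (g Θ))
    - ((ContinuousLinearMap.smulRightL ℝ E E).flip Θ).comp g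

lemma weylTensor_apply (g : E →L[ℝ] E →L[ℝ] ℝ) (Θ v a : E) :
    weylTensor g Θ v a = g Θ v • a + g Θ a • v - g v a • Θ := by
  simp [weylTensor]

end Curvature

/-! ### Curvature of a Weyl connection compared with Levi-Civita -/

section WeylCurvature

variable {E : Type*} [NormedAddCommGroup E] [NormedSpace ℝ E]

lemma differentiableAt_weylTensor {G : E → E →L[ℝ] E →L[ℝ] ℝ} {Θ : E → E} {x : E}
    (hG : DifferentiableAt ℝ G x) (hΘ : DifferentiableAt ℝ Θ x) :
    DifferentiableAt ℝ (fun z => weylTensor (G z) (Θ z)) x := by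
  have h1 : DifferentiableAt ℝ (fun z => G z (Θ z)) x := hG.clm_apply hΘ
  unfold weylTensor
  refine DifferentiableAt.sub (DifferentiableAt.add ?_ ?_) ?_
  · exact ((ContinuousLinearMap.smulRightL ℝ E (E →L[ℝ] E)).flip
      (ContinuousLinearMap.id ℝ E)).differentiableAt.comp x h1
  · exact (ContinuousLinearMap.differentiableAt _).comp x h1
  · exact ((ContinuousLinearMap.differentiableAt _).comp x hΘ).clm_comp hG

lemma fderiv_weylTensor {G : E → E →L[ℝ] E →L[ℝ] ℝ} {Θ : E → E} {x : E}
    (hG : DifferentiableAt ℝ G x) (hΘ : DifferentiableAt ℝ Θ x) (u v a : E) :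
    fderiv ℝ (fun z => weylTensor (G z) (Θ z)) x u v a =
      (fderiv ℝ G x u (Θ x) v + G x (fderiv ℝ Θ x u) v) • a
      + (fderiv ℝ G x u (Θ x) a + G x (fderiv ℝ Θ x u) a) • v
      - (fderiv ℝ G x u v a • Θ x + G x v a • fderiv ℝ Θ x u) := by
  have hd : DifferentiableAt ℝ (fun z => weylTensor (G z) (Θ z)) x :=
    differentiableAt_weylTensor hG hΘ
  have h1 : HasFDerivAt (fun z => weylTensor (G z) (Θ z) v a) _ x :=
    ((hd.hasFDerivAt.clm_apply (hasFDerivAt_const v x)).clm_apply (hasFDerivAt_const a x))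
  have g1 := hG.hasFDerivAt.clm_apply hΘ.hasFDerivAt
  have h2 : HasFDerivAt (fun z => G z (Θ z) v • a + G z (Θ z) a • v - G z v a • Θ z) _ x :=
    (((g1.clm_apply (hasFDerivAt_const v x)).smul_const a).add
      ((g1.clm_apply (hasFDerivAt_const a x)).smul_const v)).sub
      (((hG.hasFDerivAt.clm_apply (hasFDerivAt_const v x)).clm_apply
        (hasFDerivAt_const a x)).smul hΘ.hasFDerivAt)
  have h3 := h1.unique (h2.congr_of_eventuallyEq (.of_forall fun z => weylTensor_apply _ _ _ _))
  have h4 := DFunLike.congr_fun h3 u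
  simp at h4
  rw [h4]
  module

/-- Comparison of the curvatures of the Levi-Civita connection and of a Weyl connection. -/
lemma christoffelCurvature_add_weylTensor {Γ : E → E →L[ℝ] E →L[ℝ] E}
    {G : E → E →L[ℝ] E →L[ℝ] ℝ} {Θ : E → E} {x : E} (hΓ : DifferentiableAt ℝ Γ x)
    (hG : DifferentiableAt ℝ G x) (hΘ : DifferentiableAt ℝ Θ x)
    (hGs : ∀ a b, G x a b = G x b a) (hΓs : ∀ a b, Γ x a b = Γ x b a)
    (hc : ∀ v a b, fderiv ℝ G x v a b = G x (Γ x v a) b + G x a (Γ x v b))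
    (N : E → E) (hN : ∀ u, N u = fderiv ℝ Θ x u + Γ x u (Θ x)) (u v a : E) :
    christoffelCurvature (fun z => Γ z + weylTensor (G z) (Θ z)) x u v a =
      christoffelCurvature Γ x u v a
      + ((G x (N u) v - G x (N v) u) • a + G x (N u) a • v - G x (N v) a • u
        - G x v a • N u + G x u a • N v)
      + (G x (Θ x) a • (G x (Θ x) v • u - G x (Θ x) u • v)
        - G x (Θ x) (Θ x) • (G x v a • u - G x u a • v)
        + (G x v a * G x (Θ x) u - G x u a * G x (Θ x) v) • Θ x) := by
  have hW : DifferentiableAt ℝ (fun z => weylTensor (G z) (Θ z)) x :=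
    differentiableAt_weylTensor hG hΘ
  have hf : fderiv ℝ (fun z => Γ z + weylTensor (G z) (Θ z)) x =
      fderiv ℝ Γ x + fderiv ℝ (fun z => weylTensor (G z) (Θ z)) x := fderiv_add hΓ hW
  simp only [christoffelCurvature_apply, hf, add_apply, fderiv_weylTensor hG hΘ, weylTensor_apply,
    map_add, map_sub, map_smul, hc, hN]
  rw [hΓs v u, hGs v u, hGs (Γ x u v) a, hGs a (Γ x u v), hGs v (Γ x u a), hGs u (Γ x v a),
    hGs v (Θ x), hGs u (Θ x)]
  module

end WeylCurvature

/-! ### The divergence identity for the Lee field in a chart -/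

section ChartIdentity

variable {E : Type*} [NormedAddCommGroup E] [NormedSpace ℝ E]

/-- The expression in a chart of a Kähler structure `(G, J)`, with Christoffel symbols `Γ`, and of a
conformal product structure with Lee field `Θ` and projection `P` onto the first factor. -/
structure IsConformalKahlerChart (Ω : Set E) (G : E → E →L[ℝ] E →L[ℝ] ℝ)
    (Γ : E → E →L[ℝ] E →L[ℝ] E) (J P : E → E →L[ℝ] E) (Θ : E → E) (n₁ n₂ : ℕ) : Prop where
  isOpen : IsOpen Ω
  contDiffAt_metric : ∀ x ∈ Ω, ContDiffAt ℝ ∞ G x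
  contDiffAt_christoffel : ∀ x ∈ Ω, ContDiffAt ℝ ∞ Γ x
  contDiffAt_complex : ∀ x ∈ Ω, ContDiffAt ℝ ∞ J x
  contDiffAt_proj : ∀ x ∈ Ω, ContDiffAt ℝ ∞ P x
  contDiffAt_lee : ∀ x ∈ Ω, ContDiffAt ℝ ∞ Θ x
  metric_symm : ∀ x ∈ Ω, ∀ a b, G x a b = G x b a
  metric_pos : ∀ x ∈ Ω, ∀ a, a ≠ 0 → 0 < G x a a
  christoffel_symm : ∀ x ∈ Ω, ∀ a b, Γ x a b = Γ x b a
  fderiv_metric : ∀ x ∈ Ω, ∀ v a b, fderiv ℝ G x v a b = G x (Γ x v a) b + G x a (Γ x v b)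
  complex_sq : ∀ x ∈ Ω, ∀ a, J x (J x a) = - a
  complex_orthogonal : ∀ x ∈ Ω, ∀ a b, G x (J x a) (J x b) = G x a b
  fderiv_complex : ∀ x ∈ Ω, ∀ v a, fderiv ℝ J x v a = J x (Γ x v a) - Γ x v (J x a)
  proj_idem : ∀ x ∈ Ω, ∀ a, P x (P x a) = P x a
  proj_symm : ∀ x ∈ Ω, ∀ a b, G x (P x a) b = G x a (P x b)
  fderiv_proj : ∀ x ∈ Ω, ∀ v a, fderiv ℝ P x v a =
    P x ((Γ x + weylTensor (G x) (Θ x)) v a) - (Γ x + weylTensor (G x) (Θ x)) v (P x a)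
  finrank_range : ∀ x ∈ Ω, Module.finrank ℝ (LinearMap.range (P x : E →ₗ[ℝ] E)) = n₁
  finrank_ker : ∀ x ∈ Ω, Module.finrank ℝ (LinearMap.ker (P x : E →ₗ[ℝ] E)) = n₂

/-- The divergence of the vector field `V` with respect to the connection `d + Γ`. -/
noncomputable def christoffelDiv (Γ : E → E →L[ℝ] E →L[ℝ] E) (V : E → E) (x : E) : ℝ :=
  LinearMap.trace ℝ E (fderiv ℝ V x + (Γ x).flip (V x) : E →L[ℝ] E)

namespace IsConformalKahlerChart

variable {Ω : Set E} {G : E → E →L[ℝ] E →L[ℝ] ℝ}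
    {Γ : E → E →L[ℝ] E →L[ℝ] E} {J P : E → E →L[ℝ] E} {Θ : E → E} {n₁ n₂ : ℕ}

/-- The endomorphism `∇Θ - θ ⊗ Θ + ½|θ|²`. -/
noncomputable def schouten (G : E → E →L[ℝ] E →L[ℝ] ℝ) (Γ : E → E →L[ℝ] E →L[ℝ] E) (Θ : E → E)
    (x : E) : E →L[ℝ] E :=
  fderiv ℝ Θ x + (Γ x).flip (Θ x) - (G x (Θ x)).smulRight (Θ x)
    + (G x (Θ x) (Θ x) / 2) • ContinuousLinearMap.id ℝ E

/-- The projection P is D-parallel, so the D-curvature maps a to the range of P and pairs to zero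
with b. In the comparison formula the term (g(Nu,v) - g(Nv,u))a disappears since g(a,b) = 0. The
corrections -θ ⊗ Θ + ½|θ|² in H absorb all terms quadratic in Θ. -/
lemma curvature_mixed (h : IsConformalKahlerChart Ω G Γ J P Θ n₁ n₂) {x : E}
    (hx : x ∈ Ω) (u v a b : E) (ha : P x a = a) (hb : P x b = 0) :
    G x (christoffelCurvature Γ x u v a) b =
      - (G x (schouten G Γ Θ x u) a * G x v b) + G x (schouten G Γ Θ x u) b * G x v a
      + G x (schouten G Γ Θ x v) a * G x u b - G x (schouten G Γ Θ x v) b * G x u a := by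
  have hΩ := h.isOpen.mem_nhds hx
  have dΓ := (h.contDiffAt_christoffel x hx).differentiableAt (by simp)
  have dG := (h.contDiffAt_metric x hx).differentiableAt (by simp)
  have dΘ := (h.contDiffAt_lee x hx).differentiableAt (by simp)
  have dW := differentiableAt_weylTensor dG dΘ
  have hcomm := christoffelCurvature_comm (dΓ.add dW)
    ((h.contDiffAt_proj x hx).of_le ENat.LEInfty.out)
    (Filter.eventually_of_mem hΩ fun z hz => h.fderiv_proj z hz) u v a
  rw [ha] at hcomm
  have hab : G x a b = 0 := by rw [← ha, h.proj_symm x hx, hb]; simp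
  have h0 : G x (christoffelCurvature (fun z => Γ z + weylTensor (G z) (Θ z)) x u v a) b = 0 := by
    have : christoffelCurvature (fun z => Γ z + weylTensor (G z) (Θ z)) x u v a = P x _ := hcomm
    rw [this, h.proj_symm x hx, hb]; simp
  rw [christoffelCurvature_add_weylTensor dΓ dG dΘ (h.metric_symm x hx) (h.christoffel_symm x hx)
    (h.fderiv_metric x hx) (fun u => fderiv ℝ Θ x u + Γ x u (Θ x)) (fun _ => rfl)] at h0
  simp only [map_add, map_sub, map_smul, add_apply, sub_apply, smul_apply, smul_eq_mul,
    hab] at h0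
  simp only [schouten, add_apply, sub_apply, ContinuousLinearMap.flip_apply,
    ContinuousLinearMap.smulRight_apply, smul_apply, ContinuousLinearMap.id_apply, map_add,
    map_sub, map_smul, smul_eq_mul]
  linarith

/-- This is where the Kähler condition enters: the curvature of the Levi-Civita connection has all
the symmetries required by `mixed_curvature_eq_zero`, including commutation with J. -/
lemma trace_schouten [FiniteDimensional ℝ E]
    (h : IsConformalKahlerChart Ω G Γ J P Θ n₁ n₂) (h₁ : 2 ≤ n₁) (h₂ : 2 ≤ n₂) {x : E}
    (hx : x ∈ Ω) :
    (n₂ : ℝ) * LinearMap.trace ℝ E ((P x : E →ₗ[ℝ] E) ∘ₗ (schouten G Γ Θ x : E →ₗ[ℝ] E))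
      + (n₁ : ℝ) * LinearMap.trace ℝ E ((schouten G Γ Θ x : E →ₗ[ℝ] E)
        - (P x : E →ₗ[ℝ] E) ∘ₗ (schouten G Γ Θ x : E →ₗ[ℝ] E)) = 0 := by
  have hΩ := h.isOpen.mem_nhds hx
  have dΓ := (h.contDiffAt_christoffel x hx).differentiableAt (by simp)
  refine trace_projection_add_eq_zero (G x).toLinearMap₁₂ (h.metric_symm x hx) (h.metric_pos x hx)
    (P x : E →ₗ[ℝ] E) (J x : E →ₗ[ℝ] E) (schouten G Γ Θ x : E →ₗ[ℝ] E) (h.proj_idem x hx)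
    (h.proj_symm x hx) (h.finrank_range x hx) (h.finrank_ker x hx) h₁ h₂ ?_
  refine mixed_curvature_eq_zero (G x).toLinearMap₁₂ (h.metric_symm x hx)
    (P x : E →ₗ[ℝ] E) (J x : E →ₗ[ℝ] E) (h.proj_idem x hx) (h.proj_symm x hx) (h.complex_sq x hx)
    (h.complex_orthogonal x hx) (fun u v => (christoffelCurvature Γ x u v : E →ₗ[ℝ] E))
    (christoffelCurvature_swap Γ x) ?_ ?_ ?_ (schouten G Γ Θ x : E →ₗ[ℝ] E) ?_
  · intro u v a b
    have := christoffelCurvature_skew dΓ ((h.contDiffAt_metric x hx).of_le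
      ENat.LEInfty.out) (Filter.eventually_of_mem hΩ fun z hz => h.fderiv_metric z hz)
      u v a b
    rw [h.metric_symm x hx a] at this
    exact this
  · exact christoffelCurvature_bianchi dΓ
      (Filter.eventually_of_mem hΩ fun z hz => h.christoffel_symm z hz)
  · exact christoffelCurvature_comm dΓ ((h.contDiffAt_complex x hx).of_le
      ENat.LEInfty.out) (Filter.eventually_of_mem hΩ fun z hz => h.fderiv_complex z hz)
  · exact fun u v a b ha hb => h.curvature_mixed hx u v a b ha hb

/-- The combination `n₁ Θ₂ + n₂ Θ₁` of the components of the Lee field. -/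
noncomputable def leeCombination (P : E → E →L[ℝ] E) (Θ : E → E) (n₁ n₂ : ℕ) (x : E) : E :=
  (n₁ : ℝ) • (Θ x - P x (Θ x)) + (n₂ : ℝ) • P x (Θ x)

/-- The mixed scalar curvature formula for Kähler conformal products. -/
theorem christoffelDiv_leeCombination [FiniteDimensional ℝ E]
    (h : IsConformalKahlerChart Ω G Γ J P Θ n₁ n₂) (h₁ : 2 ≤ n₁) (h₂ : 2 ≤ n₂)
    {x : E} (hx : x ∈ Ω) :
    christoffelDiv Γ (leeCombination P Θ n₁ n₂) x =
      - ((n₂ * (n₂ - 1) : ℝ) * G x (P x (Θ x)) (P x (Θ x))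
        + (n₁ * (n₁ - 1) : ℝ) * G x (Θ x - P x (Θ x)) (Θ x - P x (Θ x))) := by
  have dΘ := (h.contDiffAt_lee x hx).differentiableAt (by simp)
  have dP := (h.contDiffAt_proj x hx).differentiableAt (by simp)
  have hPP : G x (P x (Θ x)) (P x (Θ x)) = G x (Θ x) (P x (Θ x)) := by
    rw [h.proj_symm x hx, h.proj_idem x hx]
  have hQQ : G x (Θ x - P x (Θ x)) (Θ x - P x (Θ x)) = G x (Θ x) (Θ x) - G x (Θ x) (P x (Θ x)) := by
    simp only [map_sub, sub_apply, hPP]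
    rw [h.metric_symm x hx (P x (Θ x)) (Θ x)]
    ring
  set N : E →L[ℝ] E := fderiv ℝ Θ x + (Γ x).flip (Θ x) with hN
  -- Since P is parallel for D = ∇ + W, its ∇-derivative is the commutator of P with the Weyl tensor
  -- W. This produces the terms with factor n₂ - n₁; the part of W acting by scalars drops out.
  have hlin : (fderiv ℝ (leeCombination P Θ n₁ n₂) x + (Γ x).flip (leeCombination P Θ n₁ n₂ x)
      : E →L[ℝ] E) = (n₁ : ℝ) • (N - P x ∘L N) + (n₂ : ℝ) • (P x ∘L N)
        + ((n₂ : ℝ) - n₁) • (G x (Θ x) (Θ x) • P x - (G x (Θ x)).smulRight (P x (Θ x))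
          - G x (Θ x) (P x (Θ x)) • ContinuousLinearMap.id ℝ E
          + (G x (P x (Θ x))).smulRight (Θ x)) := by
    have hPΘ := dP.hasFDerivAt.clm_apply dΘ.hasFDerivAt
    have hV : HasFDerivAt (leeCombination P Θ n₁ n₂) _ x :=
      ((dΘ.hasFDerivAt.sub hPΘ).const_smul (n₁ : ℝ)).add (hPΘ.const_smul (n₂ : ℝ))
    rw [hV.fderiv]
    ext u
    simp only [leeCombination, add_apply, sub_apply, smul_apply, ContinuousLinearMap.comp_apply,
      ContinuousLinearMap.flip_apply, h.fderiv_proj x hx, weylTensor_apply, map_add, map_sub,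
      map_smul, ContinuousLinearMap.smulRight_apply, ContinuousLinearMap.id_apply, hN]
    rw [h.metric_symm x hx u (Θ x), h.metric_symm x hx u (P x (Θ x))]
    module
  have tP : LinearMap.trace ℝ E (P x : E →ₗ[ℝ] E) = n₁ := by
    have hp : LinearMap.IsProj (LinearMap.range (P x : E →ₗ[ℝ] E)) (P x : E →ₗ[ℝ] E) :=
      ⟨fun v => ⟨v, rfl⟩, by rintro _ ⟨v, rfl⟩; exact h.proj_idem x hx v⟩
    rw [hp.trace, h.finrank_range x hx]
  have tI : LinearMap.trace ℝ E (LinearMap.id : E →ₗ[ℝ] E) = (n₁ : ℝ) + n₂ := by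
    rw [LinearMap.trace_id, ← h.finrank_range x hx, ← h.finrank_ker x hx]
    exact_mod_cast (LinearMap.finrank_range_add_finrank_ker (P x : E →ₗ[ℝ] E)).symm
  have tR : ∀ (f : E →L[ℝ] ℝ) (w : E),
      LinearMap.trace ℝ E ((f.smulRight w : E →L[ℝ] E) : E →ₗ[ℝ] E) = f w := by
    intro f w
    simp
  have hS := h.trace_schouten h₁ h₂ hx
  have eS : (schouten G Γ Θ x : E →ₗ[ℝ] E) = (N : E →ₗ[ℝ] E)
      - (((G x (Θ x)).smulRight (Θ x) : E →L[ℝ] E) : E →ₗ[ℝ] E)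
      + (G x (Θ x) (Θ x) / 2) • LinearMap.id := rfl
  have ePS : (P x : E →ₗ[ℝ] E) ∘ₗ (schouten G Γ Θ x : E →ₗ[ℝ] E) =
      ((P x ∘L N : E →L[ℝ] E) : E →ₗ[ℝ] E)
      - (((G x (Θ x)).smulRight (P x (Θ x)) : E →L[ℝ] E) : E →ₗ[ℝ] E)
      + (G x (Θ x) (Θ x) / 2) • (P x : E →ₗ[ℝ] E) := by
    ext u
    simp [schouten, hN]
  rw [ePS, eS] at hS
  simp only [map_add, map_sub, map_smul, tR, tP, tI, smul_eq_mul] at hS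
  have tI' : LinearMap.trace ℝ E (ContinuousLinearMap.id ℝ E : E →ₗ[ℝ] E) = (n₁ : ℝ) + n₂ := tI
  -- The trace identity `hS` eliminates the traces of N. The coefficient of |PΘ|² becomes n₂ - n₁n₂
  -- - n₂(n₂-n₁) = -n₂(n₂-1), and that of |Θ-PΘ|² becomes n₁ - n₁n₂ + n₁(n₂-n₁) = -n₁(n₁-1). The
  -- weights n₁ and n₂ are chosen so that the second derivatives occur only through the trace
  -- identity.
  rw [christoffelDiv, hlin, hPP, hQQ]
  simp only [ContinuousLinearMap.toLinearMap_add, ContinuousLinearMap.toLinearMap_sub,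
    ContinuousLinearMap.toLinearMap_smul, map_add, map_sub, map_smul, tR, tP, smul_eq_mul,
    tI']
  rw [h.metric_symm x hx (P x (Θ x)) (Θ x)]
  linarith

end IsConformalKahlerChart

end ChartIdentity

/-! ### The Riemannian density and the divergence theorem on Euclidean space -/

section Density

variable {n : ℕ}

local notation "𝔼" => EuclideanSpace ℝ (Fin n)

/-- The matrix of a bilinear form in the standard basis. -/
noncomputable def gramMatrix (g : 𝔼 →L[ℝ] 𝔼 →L[ℝ] ℝ) : Matrix (Fin n) (Fin n) ℝ :=
  Matrix.of fun i j => g (EuclideanSpace.single i 1) (EuclideanSpace.single j 1)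

/-- The standard matrix of an endomorphism of Euclidean space. -/
noncomputable def stdMatrix (A : 𝔼 →ₗ[ℝ] 𝔼) : Matrix (Fin n) (Fin n) ℝ :=
  LinearMap.toMatrix (EuclideanSpace.basisFun (Fin n) ℝ).toBasis
    (EuclideanSpace.basisFun (Fin n) ℝ).toBasis A

lemma stdMatrix_apply (A : 𝔼 →ₗ[ℝ] 𝔼) (i j : Fin n) :
    stdMatrix A i j = A (EuclideanSpace.single j 1) i := by
  simp [stdMatrix, LinearMap.toMatrix_apply]

lemma EuclideanSpace.eq_sum_single (v : 𝔼) : v = ∑ i, v i • EuclideanSpace.single i (1 : ℝ) := by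
  have := (EuclideanSpace.basisFun (Fin n) ℝ).sum_repr v
  simpa using this.symm

lemma gramMatrix_comp (g : 𝔼 →L[ℝ] 𝔼 →L[ℝ] ℝ) (A : 𝔼 →L[ℝ] 𝔼) :
    gramMatrix (g.bilinearComp A A) =
      (stdMatrix (A : 𝔼 →ₗ[ℝ] 𝔼)).transpose * gramMatrix g * stdMatrix (A : 𝔼 →ₗ[ℝ] 𝔼) := by
  ext i j
  have h1 := EuclideanSpace.eq_sum_single (A (EuclideanSpace.single i 1))
  have h2 := EuclideanSpace.eq_sum_single (A (EuclideanSpace.single j 1))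
  simp only [gramMatrix, Matrix.of_apply, ContinuousLinearMap.bilinearComp_apply, Matrix.mul_apply,
    Matrix.transpose_apply, stdMatrix_apply, ContinuousLinearMap.coe_coe]
  conv_lhs => rw [h1, h2]
  simp only [map_sum, map_smul, sum_apply, smul_apply, smul_eq_mul,
    Finset.mul_sum, Finset.sum_mul]
  refine Finset.sum_congr rfl fun a _ => Finset.sum_congr rfl fun b _ => by ring

lemma det_gramMatrix_comp (g : 𝔼 →L[ℝ] 𝔼 →L[ℝ] ℝ) (A : 𝔼 →L[ℝ] 𝔼) :
    (gramMatrix (g.bilinearComp A A)).det = A.det ^ 2 * (gramMatrix g).det := by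
  rw [gramMatrix_comp, Matrix.det_mul, Matrix.det_mul, Matrix.det_transpose, stdMatrix,
    LinearMap.det_toMatrix]
  rw [ContinuousLinearMap.det]; ring

lemma det_gramMatrix_pos {g : 𝔼 →L[ℝ] 𝔼 →L[ℝ] ℝ} (hs : ∀ a b, g a b = g b a)
    (hp : ∀ a, a ≠ 0 → 0 < g a a) : 0 < (gramMatrix g).det := by
  refine Matrix.PosDef.det_pos (Matrix.PosDef.of_dotProduct_mulVec_pos ?_ ?_)
  · ext i j
    simp [gramMatrix, hs]
  · intro v hv
    have h0 : WithLp.toLp 2 v ≠ (0 : 𝔼) := by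
      intro h
      apply hv
      have := congrArg (WithLp.ofLp) h
      simpa using this
    have := hp _ h0
    have h1 := EuclideanSpace.eq_sum_single (WithLp.toLp 2 v : 𝔼)
    rw [h1] at this
    simp only [map_sum, map_smul, sum_apply, smul_apply, smul_eq_mul,
      Finset.mul_sum] at this
    simp only [dotProduct, Matrix.mulVec, gramMatrix, Matrix.of_apply, Finset.mul_sum]
    refine lt_of_lt_of_eq this ?_
    rw [Finset.sum_comm]
    refine Finset.sum_congr rfl fun a _ => Finset.sum_congr rfl fun b _ => ?_
    simp
    ring

/-- The Riemannian density `√det g`. -/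
noncomputable def metricDensity (g : 𝔼 →L[ℝ] 𝔼 →L[ℝ] ℝ) : ℝ := √(gramMatrix g).det

lemma metricDensity_comp (g : 𝔼 →L[ℝ] 𝔼 →L[ℝ] ℝ) (A : 𝔼 →L[ℝ] 𝔼) :
    metricDensity (g.bilinearComp A A) = |A.det| * metricDensity g := by
  rw [metricDensity, det_gramMatrix_comp, Real.sqrt_mul (sq_nonneg _), Real.sqrt_sq_eq_abs,
    metricDensity]

lemma metricDensity_pos {g : 𝔼 →L[ℝ] 𝔼 →L[ℝ] ℝ} (hs : ∀ a b, g a b = g b a)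
    (hp : ∀ a, a ≠ 0 → 0 < g a a) : 0 < metricDensity g :=
  Real.sqrt_pos.2 (det_gramMatrix_pos hs hp)

lemma contDiff_det_gramMatrix :
    ContDiff ℝ ∞ (fun g : 𝔼 →L[ℝ] 𝔼 →L[ℝ] ℝ => (gramMatrix g).det) := by
  simp only [Matrix.det_apply]
  refine ContDiff.sum fun σ _ => ContDiff.const_smul _ (contDiff_prod fun i _ => ?_)
  simp only [gramMatrix, Matrix.of_apply]
  exact (contDiff_id.clm_apply contDiff_const).clm_apply contDiff_const

lemma hasDerivAt_det_one_add (A : 𝔼 →L[ℝ] 𝔼) :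
    HasDerivAt (fun t : ℝ => (ContinuousLinearMap.id ℝ 𝔼 + t • A).det)
      (LinearMap.trace ℝ 𝔼 A) 0 := by
  set b := (EuclideanSpace.basisFun (Fin n) ℝ).toBasis
  -- The polynomial remainder in det(1 + tA) = 1 + t tr A + t² p(t); it does not contribute to the
  -- derivative at 0.
  set p := (1 + (Polynomial.X : Polynomial ℝ) •
    (stdMatrix (A : 𝔼 →ₗ[ℝ] 𝔼)).map Polynomial.C).det.divX.divX with hp
  have h : ∀ t : ℝ, (ContinuousLinearMap.id ℝ 𝔼 + t • A).det =
      1 + LinearMap.trace ℝ 𝔼 A * t + p.eval t * t ^ 2 := by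
    intro t
    rw [ContinuousLinearMap.det, ← LinearMap.det_toMatrix b, LinearMap.trace_eq_matrix_trace ℝ b]
    have := Matrix.det_one_add_smul t (stdMatrix (A : 𝔼 →ₗ[ℝ] 𝔼))
    rw [← hp] at this
    rw [stdMatrix] at this
    rw [← this]
    have e : ((ContinuousLinearMap.id ℝ 𝔼 + t • A : 𝔼 →L[ℝ] 𝔼) : 𝔼 →ₗ[ℝ] 𝔼) =
        LinearMap.id + t • (A : 𝔼 →ₗ[ℝ] 𝔼) := rfl
    rw [e, map_add, map_smul, LinearMap.toMatrix_id]
  rw [funext h]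
  have h1 : HasDerivAt (fun t : ℝ => p.eval t * t ^ 2) 0 0 := by
    have := (p.hasDerivAt 0).mul (hasDerivAt_pow 2 (0 : ℝ))
    simpa using! this
  have h2 : HasDerivAt (fun t : ℝ => 1 + LinearMap.trace ℝ 𝔼 A * t) (LinearMap.trace ℝ 𝔼 A) 0 := by
    simpa using ((hasDerivAt_id (0 : ℝ)).const_mul (LinearMap.trace ℝ 𝔼
      (A : 𝔼 →ₗ[ℝ] 𝔼))).const_add 1
  simpa using! h2.add h1

/-- Jacobi's formula for Gram determinants. -/
lemma fderiv_det_gramMatrix_apply (g : 𝔼 →L[ℝ] 𝔼 →L[ℝ] ℝ) (A : 𝔼 →L[ℝ] 𝔼)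
    (g' : 𝔼 →L[ℝ] 𝔼 →L[ℝ] ℝ) (hg' : ∀ a b, g' a b = g (A a) b + g a (A b)) :
    fderiv ℝ (fun g : 𝔼 →L[ℝ] 𝔼 →L[ℝ] ℝ => (gramMatrix g).det) g g' =
      2 * LinearMap.trace ℝ 𝔼 A * (gramMatrix g).det := by
  have e : g' = g.bilinearComp A (ContinuousLinearMap.id ℝ 𝔼)
      + g.bilinearComp (ContinuousLinearMap.id ℝ 𝔼) A := by ext a b; simp [hg']
  -- The quadratic correction leaves the velocity at 0 unchanged and makes the curve the pullback of
  -- g by 1 + tA, whose Gram determinant is det(1 + tA)² det g. No inverse of g is needed.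
  have hc : HasDerivAt (fun t : ℝ => g + t • g' + t ^ 2 • g.bilinearComp A A) g' 0 := by
    have h1 : HasDerivAt (fun t : ℝ => g + t • g') g' 0 := by
      simpa using ((hasDerivAt_id (0 : ℝ)).smul_const g').const_add g
    have h2 : HasDerivAt (fun t : ℝ => t ^ 2 • g.bilinearComp A A) 0 0 := by
      simpa using! (hasDerivAt_pow 2 (0 : ℝ)).smul_const (g.bilinearComp A A)
    simpa using! h1.add h2
  have hcc : ∀ t : ℝ, g + t • g' + t ^ 2 • g.bilinearComp A A =
      g.bilinearComp (ContinuousLinearMap.id ℝ 𝔼 + t • A) (ContinuousLinearMap.id ℝ 𝔼 + t • A) := by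
    intro t
    ext a b
    simp [hg']
    ring
  have hd : DifferentiableAt ℝ (fun g : 𝔼 →L[ℝ] 𝔼 →L[ℝ] ℝ => (gramMatrix g).det)
      ((fun t : ℝ => g + t • g' + t ^ 2 • g.bilinearComp A A) 0) :=
    contDiff_det_gramMatrix.contDiffAt.differentiableAt (by simp)
  have h1 := hd.hasFDerivAt.comp_hasDerivAt (0 : ℝ) hc
  have h2 : HasDerivAt (fun t : ℝ => (ContinuousLinearMap.id ℝ 𝔼 + t • A).det ^ 2 *
      (gramMatrix g).det) (2 * LinearMap.trace ℝ 𝔼 A * (gramMatrix g).det) 0 := by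
    have := ((hasDerivAt_det_one_add A).pow 2).mul_const (gramMatrix g).det
    simpa [ContinuousLinearMap.det] using! this
  have h3 : (fun g : 𝔼 →L[ℝ] 𝔼 →L[ℝ] ℝ => (gramMatrix g).det) ∘
      (fun t : ℝ => g + t • g' + t ^ 2 • g.bilinearComp A A) =
      fun t : ℝ => (ContinuousLinearMap.id ℝ 𝔼 + t • A).det ^ 2 * (gramMatrix g).det := by
    funext t
    simp only [Function.comp_apply, hcc, det_gramMatrix_comp]
  rw [h3] at h1
  have := h1.unique h2
  simpa using this

lemma contDiffAt_metricDensity {G : 𝔼 → 𝔼 →L[ℝ] 𝔼 →L[ℝ] ℝ} {x : 𝔼} (hG : ContDiffAt ℝ ∞ G x)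
    (hs : ∀ a b, G x a b = G x b a) (hp : ∀ a, a ≠ 0 → 0 < G x a a) :
    ContDiffAt ℝ ∞ (fun z => metricDensity (G z)) x :=
  (contDiff_det_gramMatrix.contDiffAt.comp x hG).sqrt (det_gramMatrix_pos hs hp).ne'

/-- Jacobi's formula with A = Γ_v, which metric compatibility permits; the square root cancels the
factor 2. -/
lemma fderiv_metricDensity {G : 𝔼 → 𝔼 →L[ℝ] 𝔼 →L[ℝ] ℝ} {Γ : 𝔼 → 𝔼 →L[ℝ] 𝔼 →L[ℝ] 𝔼} {x : 𝔼}
    (hG : DifferentiableAt ℝ G x) (hs : ∀ a b, G x a b = G x b a) (hp : ∀ a, a ≠ 0 → 0 < G x a a)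
    (hc : ∀ v a b, fderiv ℝ G x v a b = G x (Γ x v a) b + G x a (Γ x v b)) (v : 𝔼) :
    fderiv ℝ (fun z => metricDensity (G z)) x v =
      metricDensity (G x) * LinearMap.trace ℝ 𝔼 (Γ x v) := by
  have hpos := det_gramMatrix_pos hs hp
  have hd : DifferentiableAt ℝ (fun g : 𝔼 →L[ℝ] 𝔼 →L[ℝ] ℝ => (gramMatrix g).det) (G x) :=
    contDiff_det_gramMatrix.contDiffAt.differentiableAt (by simp)
  have h1 := (hd.hasFDerivAt.comp x hG.hasFDerivAt).sqrt hpos.ne'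
  have h2 : fderiv ℝ (fun z => metricDensity (G z)) x = _ := h1.fderiv
  rw [h2]
  simp only [smul_apply, ContinuousLinearMap.comp_apply, smul_eq_mul, Function.comp_apply]
  rw [fderiv_det_gramMatrix_apply (G x) (Γ x v) _ (hc v), metricDensity]
  have h3 : √(gramMatrix (G x)).det ≠ 0 := (Real.sqrt_pos.2 hpos).ne'
  have h4 := Real.mul_self_sqrt hpos.le
  field_simp
  rw [← h4]; ring_nf
  simp [Real.sqrt_sq (Real.sqrt_nonneg _)]

/-- The derivative of the density supplies the trace of Γ_V, which by symmetry of Γ is the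
Christoffel term of the divergence. Riemannian divergence times density is thus a Euclidean
divergence. -/
lemma trace_fderiv_smul_eq {G : 𝔼 → 𝔼 →L[ℝ] 𝔼 →L[ℝ] ℝ} {Γ : 𝔼 → 𝔼 →L[ℝ] 𝔼 →L[ℝ] 𝔼}
    {x : 𝔼} (hG : ContDiffAt ℝ ∞ G x) (hs : ∀ a b, G x a b = G x b a)
    (hp : ∀ a, a ≠ 0 → 0 < G x a a)
    (hc : ∀ v a b, fderiv ℝ G x v a b = G x (Γ x v a) b + G x a (Γ x v b))
    (hΓ : ∀ a b, Γ x a b = Γ x b a) {V : 𝔼 → 𝔼} (hV : DifferentiableAt ℝ V x) {χ : 𝔼 → ℝ}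
    (hχ : DifferentiableAt ℝ χ x) :
    LinearMap.trace ℝ 𝔼 (fderiv ℝ (fun z => (χ z * metricDensity (G z)) • V z) x : 𝔼 →L[ℝ] 𝔼) =
      (χ x * christoffelDiv Γ V x + fderiv ℝ χ x (V x)) * metricDensity (G x) := by
  have hd := (contDiffAt_metricDensity hG hs hp).differentiableAt (by simp)
  have h1 := (hχ.hasFDerivAt.mul hd.hasFDerivAt).smul hV.hasFDerivAt
  have h2 : fderiv ℝ (fun z => (χ z * metricDensity (G z)) • V z) x = _ := h1.fderiv
  have hfl : (Γ x).flip (V x) = Γ x (V x) := by ext a; simp [hΓ]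
  rw [h2, christoffelDiv, hfl]
  simp only [ContinuousLinearMap.toLinearMap_add, ContinuousLinearMap.toLinearMap_smul, map_add,
    map_smul, smul_eq_mul]
  have tR : ∀ (f : 𝔼 →L[ℝ] ℝ) (w : 𝔼),
      LinearMap.trace ℝ 𝔼 ((f.smulRight w : 𝔼 →L[ℝ] 𝔼) : 𝔼 →ₗ[ℝ] 𝔼) = f w := by
    intro f w
    simp
  rw [tR]
  simp only [add_apply, smul_apply, smul_eq_mul, Pi.mul_apply]
  rw [fderiv_metricDensity (hG.differentiableAt (by simp)) hs hp hc]
  ring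

open MeasureTheory

/-- The divergence theorem for compactly supported vector fields on Euclidean space. -/
lemma integral_trace_fderiv_eq_zero {W : 𝔼 → 𝔼} (hW : ContDiff ℝ 1 W) (hc : HasCompactSupport W) :
    ∫ x, LinearMap.trace ℝ 𝔼 (fderiv ℝ W x : 𝔼 →L[ℝ] 𝔼) = 0 := by
  have hd : Differentiable ℝ W := hW.differentiable (by norm_num)
  have hcoord : ∀ i : Fin n, ContDiff ℝ 1 (fun x => W x i) := fun i =>
    (EuclideanSpace.proj (𝕜 := ℝ) i).contDiff.comp hW
  have hcc : ∀ i : Fin n, HasCompactSupport (fun x => W x i) := fun i =>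
    hc.comp_left (g := fun w : 𝔼 => w i) rfl
  have e1 : ∀ x, LinearMap.trace ℝ 𝔼 (fderiv ℝ W x : 𝔼 →L[ℝ] 𝔼) =
      ∑ i, fderiv ℝ (fun x => W x i) x (EuclideanSpace.single i 1) := by
    intro x
    rw [LinearMap.trace_eq_matrix_trace ℝ (EuclideanSpace.basisFun (Fin n) ℝ).toBasis,
      Matrix.trace]
    refine Finset.sum_congr rfl fun i _ => ?_
    have h1 : HasFDerivAt (fun x => W x i) _ x :=
      (EuclideanSpace.proj (𝕜 := ℝ) i).hasFDerivAt.comp x (hd x).hasFDerivAt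
    rw [h1.fderiv]
    simp [LinearMap.toMatrix_apply]
  have hint : ∀ i : Fin n, Integrable
      (fun x => fderiv ℝ (fun x => W x i) x (EuclideanSpace.single i 1)) := by
    intro i
    refine Continuous.integrable_of_hasCompactSupport ?_ ?_
    · exact ((hcoord i).continuous_fderiv (by norm_num)).clm_apply continuous_const
    · exact (hcc i).fderiv_apply ℝ _
  simp_rw [e1]
  rw [integral_finsetSum _ fun i _ => hint i]
  refine Finset.sum_eq_zero fun i _ => ?_
  -- Integration by parts against the constant function 1.
  have := integral_mul_fderiv_eq_neg_fderiv_mul_of_integrable (μ := volume)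
    (f := fun _ : 𝔼 => (1 : ℝ))
    (g := fun x => W x i) (v := EuclideanSpace.single i 1) (by simp) (by simpa using hint i)
    (by simpa using (hcoord i).continuous.integrable_of_hasCompactSupport (hcc i))
    (fun x _ => differentiableAt_const _) (fun x _ => (hcoord i).differentiable (by norm_num) x)
  simpa using this

end Density

/-! ### Vector fields and connections in a chart -/

section Coordinates

variable {n : ℕ} {M : Type*} [TopologicalSpace M]
  [ChartedSpace (EuclideanSpace ℝ (Fin n)) M] {x₀ y : M}

local notation "𝔼" => EuclideanSpace ℝ (Fin n)

lemma mvfderiv_congr {f g : M → ℝ} (h : f =ᶠ[𝓝 y] g) :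
    mvfderiv (𝓡 n) f y = mvfderiv (𝓡 n) g y := by
  simp only [mvfderiv, h.mfderiv_eq]
  rw [h.self_of_nhds]

lemma source_mem_nhds (hy : y ∈ (chartAt 𝔼 x₀).source) : (chartAt 𝔼 x₀).source ∈ 𝓝 y :=
  (chartAt 𝔼 x₀).open_source.mem_nhds hy

lemma extChartAt_symm_mem_source {z : 𝔼} (hz : z ∈ (extChartAt (𝓡 n) x₀).target) :
    (extChartAt (𝓡 n) x₀).symm z ∈ (chartAt 𝔼 x₀).source := by
  have := (extChartAt (𝓡 n) x₀).map_target hz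
  rwa [extChartAt_source] at this

lemma extChartAt_symm_extChartAt (hy : y ∈ (chartAt 𝔼 x₀).source) :
    (extChartAt (𝓡 n) x₀).symm (extChartAt (𝓡 n) x₀ y) = y :=
  (extChartAt (𝓡 n) x₀).left_inv (by rwa [extChartAt_source])

variable [IsManifold (𝓡 n) ∞ M]

/-- The coordinate expression of tangent vectors at `y` in the chart centred at `x₀`. -/
noncomputable def toCoord (x₀ y : M) : TangentSpace (𝓡 n) y →L[ℝ] 𝔼 :=
  (trivializationAt 𝔼 (TangentSpace (𝓡 n)) x₀).continuousLinearMapAt ℝ y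

/-- The tangent vector at `y` with given coordinates in the chart centred at `x₀`. -/
noncomputable def ofCoord (x₀ y : M) : 𝔼 →L[ℝ] TangentSpace (𝓡 n) y :=
  (trivializationAt 𝔼 (TangentSpace (𝓡 n)) x₀).symmL ℝ y

lemma toCoord_ofCoord (hy : y ∈ (chartAt 𝔼 x₀).source) (a : 𝔼) :
    toCoord x₀ y (ofCoord x₀ y a) = a :=
  Trivialization.continuousLinearMapAt_symmL _ (by simpa using hy) a

lemma ofCoord_toCoord (hy : y ∈ (chartAt 𝔼 x₀).source) (v : TangentSpace (𝓡 n) y) :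
    ofCoord x₀ y (toCoord x₀ y v) = v :=
  Trivialization.symmL_continuousLinearMapAt _ (by simpa using hy) v

lemma toCoord_injective (hy : y ∈ (chartAt 𝔼 x₀).source) :
    Function.Injective (toCoord (n := n) x₀ y) :=
  Function.LeftInverse.injective (ofCoord_toCoord hy)

lemma ofCoord_injective (hy : y ∈ (chartAt 𝔼 x₀).source) :
    Function.Injective (ofCoord (n := n) x₀ y) :=
  Function.LeftInverse.injective (toCoord_ofCoord hy)

lemma toCoord_eq_mfderiv (hy : y ∈ (chartAt 𝔼 x₀).source) :
    toCoord x₀ y = mfderiv (𝓡 n) 𝓘(ℝ, 𝔼) (extChartAt (𝓡 n) x₀) y :=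
  TangentBundle.continuousLinearMapAt_trivializationAt hy

lemma contMDiffAt_section_iff_toCoord (hy : y ∈ (chartAt 𝔼 x₀).source)
    (s : Π y : M, TangentSpace (𝓡 n) y) :
    ContMDiffAt (𝓡 n) ((𝓡 n).prod 𝓘(ℝ, 𝔼)) ∞
      (fun y ↦ TotalSpace.mk' 𝔼 (E := fun x : M ↦ TangentSpace (𝓡 n) x) y (s y)) y ↔
    ContMDiffAt (𝓡 n) 𝓘(ℝ, 𝔼) ∞ (fun y => toCoord x₀ y (s y)) y := by
  have hb : y ∈ (trivializationAt 𝔼 (TangentSpace (𝓡 n)) x₀).baseSet := by simpa using hy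
  refine (Trivialization.contMDiffAt_section_iff
    (trivializationAt 𝔼 (TangentSpace (𝓡 n) : M → Type _) x₀) hb).trans ?_
  refine Filter.EventuallyEq.contMDiffAt_iff ?_
  filter_upwards [(trivializationAt 𝔼 (TangentSpace (𝓡 n)) x₀).open_baseSet.mem_nhds hb] with z hz
  rw [toCoord, Trivialization.continuousLinearMapAt_apply,
    Trivialization.coe_linearMapAt_of_mem _ hz]

lemma contDiffAt_comp_symm {F : Type*} [NormedAddCommGroup F] [NormedSpace ℝ F] {f : M → F}
    {z : 𝔼} (hz : z ∈ (extChartAt (𝓡 n) x₀).target)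
    (hf : ContMDiffAt (𝓡 n) 𝓘(ℝ, F) ∞ f ((extChartAt (𝓡 n) x₀).symm z)) :
    ContDiffAt ℝ ∞ (fun z => f ((extChartAt (𝓡 n) x₀).symm z)) z := by
  have h1 : ContMDiffAt 𝓘(ℝ, 𝔼) (𝓡 n) ∞ (extChartAt (𝓡 n) x₀).symm z :=
    (contMDiffOn_extChartAt_symm x₀).contMDiffAt ((isOpen_extChartAt_target x₀).mem_nhds hz)
  exact (hf.comp z h1).contDiffAt

lemma contMDiffAt_comp_extChartAt {F : Type*} [NormedAddCommGroup F] [NormedSpace ℝ F] {f : 𝔼 → F}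
    (hy : y ∈ (chartAt 𝔼 x₀).source) (hf : ContDiffAt ℝ ∞ f (extChartAt (𝓡 n) x₀ y)) :
    ContMDiffAt (𝓡 n) 𝓘(ℝ, F) ∞ (fun y => f (extChartAt (𝓡 n) x₀ y)) y :=
  hf.contMDiffAt.comp y (contMDiffAt_extChartAt' hy)

/-- Derivatives of functions in coordinates. -/
lemma mvfderiv_comp_extChartAt {f : 𝔼 → ℝ} (hy : y ∈ (chartAt 𝔼 x₀).source)
    (hf : DifferentiableAt ℝ f (extChartAt (𝓡 n) x₀ y)) (v : TangentSpace (𝓡 n) y) :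
    mvfderiv (𝓡 n) (fun y => f (extChartAt (𝓡 n) x₀ y)) y v =
      fderiv ℝ f (extChartAt (𝓡 n) x₀ y) (toCoord x₀ y v) := by
  have h1 := mvfderiv_comp_apply (I := 𝓘(ℝ, 𝔼)) (I' := 𝓡 n) (f := extChartAt (𝓡 n) x₀) (g := f) y
    hf.mdifferentiableAt (mdifferentiableAt_extChartAt hy) v
  rw [← toCoord_eq_mfderiv hy] at h1
  refine h1.trans ?_
  simp [mvfderiv, mfderiv_eq_fderiv]
  rfl

lemma contMDiffAt_ofCoord {w : M → 𝔼} (hy : y ∈ (chartAt 𝔼 x₀).source)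
    (hw : ContMDiffAt (𝓡 n) 𝓘(ℝ, 𝔼) ∞ w y) :
    ContMDiffAt (𝓡 n) ((𝓡 n).prod 𝓘(ℝ, 𝔼)) ∞
      (fun y ↦ TotalSpace.mk' 𝔼 (E := fun x : M ↦ TangentSpace (𝓡 n) x) y
        (ofCoord x₀ y (w y))) y := by
  rw [contMDiffAt_section_iff_toCoord hy]
  refine hw.congr_of_eventuallyEq ?_
  filter_upwards [source_mem_nhds hy] with z hz
  rw [toCoord_ofCoord hz]

lemma diffVectorFieldAt_ofCoord {w : M → 𝔼} (hy : y ∈ (chartAt 𝔼 x₀).source)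
    (hw : ContMDiffAt (𝓡 n) 𝓘(ℝ, 𝔼) ∞ w y) :
    DiffVectorFieldAt (fun y => ofCoord x₀ y (w y)) y :=
  (contMDiffAt_ofCoord hy hw).mdifferentiableAt (by simp)

/-- The Christoffel symbols of a connection in the chart centred at `x₀`. -/
noncomputable def christoffel (D : AffineConnection n M) (x₀ : M) (z : 𝔼) : 𝔼 →L[ℝ] 𝔼 →L[ℝ] 𝔼 :=
  let y := (extChartAt (𝓡 n) x₀).symm z
  ∑ i : Fin n, (ContinuousLinearMap.smulRightL ℝ 𝔼 𝔼 (EuclideanSpace.proj (𝕜 := ℝ) i)).comp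
    (toCoord x₀ y ∘L D (fun y => ofCoord x₀ y (EuclideanSpace.single i 1)) y ∘L ofCoord x₀ y)

lemma christoffel_apply (D : AffineConnection n M) (x₀ : M) (z v a : 𝔼) :
    christoffel D x₀ z v a = ∑ i : Fin n, a i • toCoord x₀ ((extChartAt (𝓡 n) x₀).symm z)
      (D (fun y => ofCoord x₀ y (EuclideanSpace.single i 1)) ((extChartAt (𝓡 n) x₀).symm z)
        (ofCoord x₀ _ v)) := by
  simp only [christoffel, sum_apply]
  rfl

lemma connection_sum {ι : Type*} (D : AffineConnection n M) (s : Finset ι)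
    (X : ι → Π y : M, TangentSpace (𝓡 n) y) (hX : ∀ i, DiffVectorFieldAt (X i) y) :
    D (fun y => ∑ i ∈ s, X i y) y = ∑ i ∈ s, D (X i) y := by
  classical
  induction s using Finset.induction_on with
  | empty =>
    have := D.isCovariantDerivativeOnUniv.zero (x := y)
    simp only [Finset.sum_empty]
    exact this
  | insert i s hi ih =>
    have h1 : (fun y => ∑ j ∈ insert i s, X j y) = X i + fun y => ∑ j ∈ s, X j y := by
      funext y
      simp [Finset.sum_insert hi]
    have h2 : DiffVectorFieldAt (fun y => ∑ j ∈ s, X j y) y :=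
      MDifferentiableAt.sum_section fun j _ => hX j
    rw [h1, D.isCovariantDerivativeOnUniv.add (hX i) h2, ih, Finset.sum_insert hi]

/-- Covariant derivatives in coordinates. -/
lemma connection_apply_ofCoord (D : AffineConnection n M)
    (hy : y ∈ (chartAt 𝔼 x₀).source) {w : 𝔼 → 𝔼}
    (hw : ContDiffAt ℝ ∞ w (extChartAt (𝓡 n) x₀ y)) (v : TangentSpace (𝓡 n) y) :
    D (fun y => ofCoord x₀ y (w (extChartAt (𝓡 n) x₀ y))) y v =
      ofCoord x₀ y (fderiv ℝ w (extChartAt (𝓡 n) x₀ y) (toCoord x₀ y v)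
        + christoffel D x₀ (extChartAt (𝓡 n) x₀ y) (toCoord x₀ y v)
          (w (extChartAt (𝓡 n) x₀ y))) := by
  set z := extChartAt (𝓡 n) x₀ y with hz
  set X : Fin n → Π y : M, TangentSpace (𝓡 n) y :=
    fun i y => ofCoord x₀ y (EuclideanSpace.single i 1) with hXdef
  set f : Fin n → M → ℝ := fun i y => w (extChartAt (𝓡 n) x₀ y) i with hf
  have hX : ∀ i, DiffVectorFieldAt (X i) y := fun i =>
    diffVectorFieldAt_ofCoord hy contMDiffAt_const
  have hwi : ∀ i, ContDiffAt ℝ ∞ (fun z => w z i) z := fun i =>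
    (EuclideanSpace.proj (𝕜 := ℝ) i).contDiff.contDiffAt.comp z hw
  have hfd : ∀ i, MDifferentiableAt (𝓡 n) 𝓘(ℝ, ℝ) (f i) y := fun i =>
    (contMDiffAt_comp_extChartAt hy (hwi i)).mdifferentiableAt (by simp)
  -- `ofCoord` is linear at every point, even off the chart domain, so this is an equality of global
  -- sections and locality of D is not needed here.
  have e1 : (fun y => ofCoord x₀ y (w (extChartAt (𝓡 n) x₀ y))) =
      fun y => ∑ i, (f i • X i) y := by
    funext y
    conv_lhs => rw [EuclideanSpace.eq_sum_single (w (extChartAt (𝓡 n) x₀ y))]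
    rw [map_sum]
    simp only [map_smul]
    rfl
  have hfX : ∀ i, DiffVectorFieldAt (f i • X i) y := fun i =>
    (hfd i).smul_section (hX i)
  have e2 : ∀ i, D (f i • X i) y v = f i y • D (X i) y v +
      (fderiv ℝ w z (toCoord x₀ y v) i) • X i y := by
    intro i
    rw [D.isCovariantDerivativeOnUniv.leibniz (hX i) (hfd i)]
    have h3 : mvfderiv (𝓡 n) (f i) y v = fderiv ℝ w z (toCoord x₀ y v) i := by
      have h4 := mvfderiv_comp_extChartAt hy ((hwi i).differentiableAt (by simp)) v
      have h5 : HasFDerivAt (fun z => w z i) _ z :=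
        (EuclideanSpace.proj (𝕜 := ℝ) i).hasFDerivAt.comp z
          (hw.differentiableAt (by simp)).hasFDerivAt
      rw [h5.fderiv] at h4
      exact h4
    simp [h3]
  have hback : (extChartAt (𝓡 n) x₀).symm z = y := extChartAt_symm_extChartAt hy
  rw [e1, connection_sum D _ _ hfX, sum_apply]
  simp only [e2, Finset.sum_add_distrib]
  rw [map_add, add_comm]
  congr 1
  · conv_rhs => rw [EuclideanSpace.eq_sum_single (fderiv ℝ w z (toCoord x₀ y v))]
    rw [map_sum]
    simp only [map_smul]
    rfl
  · rw [christoffel_apply, hback, map_sum]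
    simp only [map_smul, ofCoord_toCoord hy]
    rfl

lemma christoffel_eq (D : AffineConnection n M)
    (hy : y ∈ (chartAt 𝔼 x₀).source) (a : 𝔼) (v : TangentSpace (𝓡 n) y) :
    christoffel D x₀ (extChartAt (𝓡 n) x₀ y) (toCoord x₀ y v) a =
      toCoord x₀ y (D (fun y => ofCoord x₀ y a) y v) := by
  have := connection_apply_ofCoord D hy (w := fun _ => a) contDiffAt_const v
  rw [this, toCoord_ofCoord hy]
  simp

end Coordinates

/-! ### Koszul formula and inversion of the metric -/

section ChartMetric

variable {E : Type*} [NormedAddCommGroup E] [NormedSpace ℝ E]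

lemma metric_eq_of_forall {g : E →L[ℝ] E →L[ℝ] ℝ} (hp : ∀ a, a ≠ 0 → 0 < g a a) {a b : E}
    (h : ∀ c, g a c = g b c) : a = b := by
  by_contra hne
  have h1 := hp (a - b) (sub_ne_zero.2 hne)
  simp [h] at h1

/-- A Weyl connection is determined by its Lee field. -/
lemma weyl_christoffel_unique {g : E →L[ℝ] E →L[ℝ] ℝ} (hs : ∀ a b, g a b = g b a)
    (hp : ∀ a, a ≠ 0 → 0 < g a a) {Γ Γ' : E →L[ℝ] E →L[ℝ] E} (hΓ : ∀ a b, Γ a b = Γ b a)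
    (hΓ' : ∀ a b, Γ' a b = Γ' b a) (Θ : E)
    (h : ∀ v a b, g (Γ' v a) b + g a (Γ' v b) - (g (Γ v a) b + g a (Γ v b)) =
      2 * g Θ v * g a b) : Γ' = Γ + weylTensor g Θ := by
  ext v a
  refine metric_eq_of_forall hp fun b => ?_
  -- Koszul's trick: the compatibility identity in three permutations of (v, a, b), combined by
  -- symmetry of both connections.
  have h1 := h v a b
  have h2 := h a v b
  have h3 := h b v a
  rw [hΓ' b v, hΓ' b a, hΓ b v, hΓ b a] at h3
  rw [hΓ' a v, hΓ a v] at h2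
  simp only [add_apply, weylTensor_apply, map_add, map_sub, map_smul, sub_apply, smul_apply,
    smul_eq_mul]
  rw [hs a (Γ' v b), hs a (Γ v b)] at h1
  rw [hs v (Γ' a b), hs v (Γ a b)] at h2
  rw [hs v (Γ' a b), hs v (Γ a b)] at h3
  linarith [hs v a]

variable [FiniteDimensional ℝ E]

lemma metric_exists_equiv {g : E →L[ℝ] E →L[ℝ] ℝ} (hp : ∀ a, a ≠ 0 → 0 < g a a) :
    ∃ e : E ≃L[ℝ] (E →L[ℝ] ℝ), (e : E →L[ℝ] E →L[ℝ] ℝ) = g := by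
  have hinj : Function.Injective (g : E →ₗ[ℝ] (E →L[ℝ] ℝ)) := by
    rw [injective_iff_map_eq_zero]
    intro a ha
    by_contra hne
    have h1 := hp a hne
    have h2 : g a = 0 := ha
    rw [h2] at h1
    simp at h1
  have hfr : Module.finrank ℝ E = Module.finrank ℝ (E →L[ℝ] ℝ) := by
    rw [← (LinearMap.toContinuousLinearMap (𝕜 := ℝ) (E := E) (F' := ℝ)).finrank_eq]
    exact (Subspace.dual_finrank_eq (K := ℝ) (V := E)).symm
  refine ⟨(LinearEquiv.ofInjectiveOfFinrankEq _ hinj hfr).toContinuousLinearEquiv, ?_⟩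
  ext a b
  rfl

lemma metric_inverse_apply {g : E →L[ℝ] E →L[ℝ] ℝ} (hp : ∀ a, a ≠ 0 → 0 < g a a)
    (f : E →L[ℝ] ℝ) : g (g.inverse f) = f := by
  obtain ⟨e, rfl⟩ := metric_exists_equiv hp
  simp

lemma contDiffAt_metric_inverse {G : E → E →L[ℝ] E →L[ℝ] ℝ} {x : E} (hG : ContDiffAt ℝ ∞ G x)
    (hp : ∀ a, a ≠ 0 → 0 < G x a a) : ContDiffAt ℝ ∞ (fun z => (G z).inverse) x := by
  obtain ⟨e, he⟩ := metric_exists_equiv hp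
  have h1 : ContDiffAt ℝ ∞ ContinuousLinearMap.inverse (G x) := by
    rw [← he]; exact contDiffAt_map_inverse e
  exact h1.comp x hG

/-- The Christoffel symbols of a smooth metric are smooth, by the Koszul formula. -/
lemma contDiffAt_christoffel_of_metric {Ω : Set E} (hΩ : IsOpen Ω) {G : E → E →L[ℝ] E →L[ℝ] ℝ}
    {Γ : E → E →L[ℝ] E →L[ℝ] E} (hG : ∀ x ∈ Ω, ContDiffAt ℝ ∞ G x)
    (hs : ∀ x ∈ Ω, ∀ a b, G x a b = G x b a) (hp : ∀ x ∈ Ω, ∀ a, a ≠ 0 → 0 < G x a a)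
    (hΓ : ∀ x ∈ Ω, ∀ a b, Γ x a b = Γ x b a)
    (hc : ∀ x ∈ Ω, ∀ v a b, fderiv ℝ G x v a b = G x (Γ x v a) b + G x a (Γ x v b))
    {x : E} (hx : x ∈ Ω) : ContDiffAt ℝ ∞ Γ x := by
  suffices h : ContDiffOn ℝ ∞ Γ Ω from h.contDiffAt (hΩ.mem_nhds hx)
  rw [contDiffOn_clm_apply]
  intro v
  rw [contDiffOn_clm_apply]
  intro a z hz
  refine ContDiffAt.contDiffWithinAt ?_
  have hG' : ContDiffAt ℝ ∞ (fderiv ℝ G) z := (hG z hz).fderiv_right (by simp)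
  -- The right-hand side of the Koszul formula, which is manifestly smooth; below it is identified
  -- with Γ near z.
  have h1 : ContDiffAt ℝ ∞ (fun z => (G z).inverse ((1 / 2 : ℝ) •
      (fderiv ℝ G z v a + fderiv ℝ G z a v - ((fderiv ℝ G z).flip v).flip a))) z := by
    refine (contDiffAt_metric_inverse (hG z hz) (hp z hz)).clm_apply (ContDiffAt.const_smul _ ?_)
    refine ContDiffAt.sub (ContDiffAt.add ?_ ?_) ?_
    · exact (hG'.clm_apply contDiffAt_const).clm_apply contDiffAt_const
    · exact (hG'.clm_apply contDiffAt_const).clm_apply contDiffAt_const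
    · have h2 : ContDiffAt ℝ ∞ (fun z => (fderiv ℝ G z).flip v) z :=
        ((ContinuousLinearMap.flipₗᵢ ℝ E E (E →L[ℝ] ℝ)).contDiff.contDiffAt.comp z hG').clm_apply
          contDiffAt_const
      exact ((ContinuousLinearMap.flipₗᵢ ℝ E E ℝ).contDiff.contDiffAt.comp z h2).clm_apply
          contDiffAt_const
  refine h1.congr_of_eventuallyEq ?_
  filter_upwards [hΩ.mem_nhds hz] with y hy
  refine metric_eq_of_forall (hp y hy) fun b => ?_
  rw [metric_inverse_apply (hp y hy)]
  simp only [smul_apply, add_apply, sub_apply, ContinuousLinearMap.flip_apply, hc y hy,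
    smul_eq_mul]
  rw [hΓ y hy a v, hΓ y hy b v, hΓ y hy b a, hs y hy a (Γ y v b)]
  ring

end ChartMetric

/-! ### The metric and its connections in a chart -/

section ManifoldMetric

variable {n : ℕ} {M : Type*} [TopologicalSpace M]
  [ChartedSpace (EuclideanSpace ℝ (Fin n)) M] [IsManifold (𝓡 n) ∞ M] {x₀ : M}

local notation "𝔼" => EuclideanSpace ℝ (Fin n)

/-- The metric in the chart centred at `x₀`. -/
noncomputable def chartMetric (g : SmoothMetric n M) (x₀ : M) (z : 𝔼) : 𝔼 →L[ℝ] 𝔼 →L[ℝ] ℝ :=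
  ContinuousLinearMap.bilinearComp (E := 𝔼) (F := 𝔼) (g.inner ((extChartAt (𝓡 n) x₀).symm z))
    (ofCoord x₀ ((extChartAt (𝓡 n) x₀).symm z)) (ofCoord x₀ ((extChartAt (𝓡 n) x₀).symm z))

lemma chartMetric_apply (g : SmoothMetric n M) (x₀ : M) (z a b : 𝔼) :
    chartMetric g x₀ z a b = g.inner ((extChartAt (𝓡 n) x₀).symm z) (ofCoord x₀ _ a)
      (ofCoord x₀ _ b) := rfl

lemma chartMetric_symm (g : SmoothMetric n M) (x₀ : M) (z a b : 𝔼) :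
    chartMetric g x₀ z a b = chartMetric g x₀ z b a := by
  rw [chartMetric_apply, chartMetric_apply, g.symm]

lemma chartMetric_pos (g : SmoothMetric n M) {z : 𝔼} (hz : z ∈ (extChartAt (𝓡 n) x₀).target)
    (a : 𝔼) (ha : a ≠ 0) : 0 < chartMetric g x₀ z a a := by
  rw [chartMetric_apply]
  refine g.pos _ _ fun h => ha ?_
  exact ofCoord_injective (extChartAt_symm_mem_source hz) (by rw [h, map_zero])

lemma chartMetric_toCoord (g : SmoothMetric n M) {z : 𝔼} (hz : z ∈ (extChartAt (𝓡 n) x₀).target)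
    (v w : TangentSpace (𝓡 n) ((extChartAt (𝓡 n) x₀).symm z)) :
    chartMetric g x₀ z (toCoord x₀ _ v) (toCoord x₀ _ w) = g.inner _ v w := by
  rw [chartMetric_apply, ofCoord_toCoord (extChartAt_symm_mem_source hz),
    ofCoord_toCoord (extChartAt_symm_mem_source hz)]

lemma contDiffAt_chartMetric (g : SmoothMetric n M) {z : 𝔼}
    (hz : z ∈ (extChartAt (𝓡 n) x₀).target) : ContDiffAt ℝ ∞ (chartMetric g x₀) z := by
  have hΩ := isOpen_extChartAt_target (I := 𝓡 n) x₀
  suffices h : ContDiffOn ℝ ∞ (chartMetric g x₀) (extChartAt (𝓡 n) x₀).target from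
    h.contDiffAt (hΩ.mem_nhds hz)
  rw [contDiffOn_clm_apply]
  intro a
  rw [contDiffOn_clm_apply]
  intro b z hz
  have hy := extChartAt_symm_mem_source hz
  refine ContDiffAt.contDiffWithinAt ?_
  have h1 : ContMDiffAt (𝓡 n) ((𝓡 n).prod 𝓘(ℝ, ℝ)) ∞
      (fun y ↦ TotalSpace.mk' ℝ (E := Bundle.Trivial M ℝ) y
        (g.inner y (ofCoord x₀ y a) (ofCoord x₀ y b))) ((extChartAt (𝓡 n) x₀).symm z) := by
    apply ContMDiffAt.clm_bundle_apply₂ (F₁ := 𝔼) (F₂ := 𝔼)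
    · exact g.contMDiff _
    · exact contMDiffAt_ofCoord hy contMDiffAt_const
    · exact contMDiffAt_ofCoord hy contMDiffAt_const
  rw [contMDiffAt_section] at h1
  exact contDiffAt_comp_symm hz h1

lemma fderiv_chartMetric (g : SmoothMetric n M) {z : 𝔼}
    (hz : z ∈ (extChartAt (𝓡 n) x₀).target) (v a b : 𝔼) :
    fderiv ℝ (chartMetric g x₀) z v a b =
      mvfderiv (𝓡 n) (fun y => g.inner y (ofCoord x₀ y a) (ofCoord x₀ y b))
        ((extChartAt (𝓡 n) x₀).symm z) (ofCoord x₀ _ v) := by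
  have hy := extChartAt_symm_mem_source hz
  have hz' := (extChartAt (𝓡 n) x₀).right_inv hz
  have hd := (contDiffAt_chartMetric g hz).differentiableAt (by simp)
  have h1 : HasFDerivAt (fun z => chartMetric g x₀ z a b) _ z :=
    (hd.hasFDerivAt.clm_apply (hasFDerivAt_const a z)).clm_apply (hasFDerivAt_const b z)
  have h2 : (fun y => g.inner y (ofCoord x₀ y a) (ofCoord x₀ y b)) =ᶠ[𝓝
      ((extChartAt (𝓡 n) x₀).symm z)]
      fun y => (fun z => chartMetric g x₀ z a b) (extChartAt (𝓡 n) x₀ y) := by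
    filter_upwards [source_mem_nhds hy] with y hy
    simp only [chartMetric_apply]
    rw [extChartAt_symm_extChartAt hy]
  rw [mvfderiv_congr h2, mvfderiv_comp_extChartAt (f := fun z => chartMetric g x₀ z a b) hy
    (by rw [hz']; exact h1.differentiableAt),
    toCoord_ofCoord hy, hz', h1.fderiv]
  simp

lemma christoffel_eq_target (D : AffineConnection n M) {z : 𝔼}
    (hz : z ∈ (extChartAt (𝓡 n) x₀).target) (v a : 𝔼) :
    D (fun y => ofCoord x₀ y a) ((extChartAt (𝓡 n) x₀).symm z) (ofCoord x₀ _ v) =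
      ofCoord x₀ _ (christoffel D x₀ z v a) := by
  have hy := extChartAt_symm_mem_source hz
  have h := christoffel_eq D hy a (ofCoord x₀ _ v)
  rw [toCoord_ofCoord hy, (extChartAt (𝓡 n) x₀).right_inv hz] at h
  rw [h, ofCoord_toCoord hy]

/-- Compatibility tested on coordinate fields. The case θ = 0 covers the Levi-Civita connection. -/
lemma fderiv_chartMetric_of_weyl (g : SmoothMetric n M) (D : AffineConnection n M)
    (θ : Π x : M, TangentSpace (𝓡 n) x →L[ℝ] ℝ)
    (h : ∀ (x : M) (Y Z : Π y : M, TangentSpace (𝓡 n) y),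
      DiffVectorFieldAt Y x → DiffVectorFieldAt Z x → ∀ v : TangentSpace (𝓡 n) x,
        mvfderiv (𝓡 n) (fun y ↦ g.inner y (Y y) (Z y)) x v
          - g.inner x (D Y x v) (Z x) - g.inner x (Y x) (D Z x v)
        = -2 * θ x v * g.inner x (Y x) (Z x)) {z : 𝔼}
    (hz : z ∈ (extChartAt (𝓡 n) x₀).target) (v a b : 𝔼) :
    fderiv ℝ (chartMetric g x₀) z v a b =
      chartMetric g x₀ z (christoffel D x₀ z v a) b + chartMetric g x₀ z a (christoffel D x₀ z v b)
        - 2 * θ ((extChartAt (𝓡 n) x₀).symm z) (ofCoord x₀ _ v) * chartMetric g x₀ z a b := by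
  have hy := extChartAt_symm_mem_source hz
  have h1 := h _ _ _ (diffVectorFieldAt_ofCoord (w := fun _ => a) hy contMDiffAt_const)
    (diffVectorFieldAt_ofCoord (w := fun _ => b) hy contMDiffAt_const) (ofCoord x₀ _ v)
  rw [← fderiv_chartMetric g hz, christoffel_eq_target D hz, christoffel_eq_target D hz] at h1
  simp only [chartMetric_apply]
  linarith

/-- Coordinate vector fields commute. -/
lemma mlieBracket_ofCoord {y : M} (hy : y ∈ (chartAt 𝔼 x₀).source) (a b : 𝔼) :
    VectorField.mlieBracket (𝓡 n) (fun y => ofCoord x₀ y a) (fun y => ofCoord x₀ y b) y = 0 := by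
  -- Coordinate fields are pullbacks of constant fields by the chart, and Lie brackets commute with
  -- pullback.
  have key : ∀ a : 𝔼, (fun y : M => ofCoord x₀ y a) =ᶠ[𝓝 y]
      VectorField.mpullback (𝓡 n) 𝓘(ℝ, 𝔼) (extChartAt (𝓡 n) x₀) (fun _ => a) := by
    intro a
    filter_upwards [source_mem_nhds hy] with y hy
    change ofCoord x₀ y a = (mfderiv (𝓡 n) 𝓘(ℝ, 𝔼) (extChartAt (𝓡 n) x₀) y).inverse a
    rw [← toCoord_eq_mfderiv hy]
    let e : TangentSpace (𝓡 n) y ≃L[ℝ] 𝔼 := ContinuousLinearEquiv.equivOfInverse (toCoord x₀ y)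
      (ofCoord x₀ y) (ofCoord_toCoord hy) (toCoord_ofCoord hy)
    have he : toCoord x₀ y = (e : TangentSpace (𝓡 n) y →L[ℝ] 𝔼) := rfl
    rw [he]
    exact (DFunLike.congr_fun (ContinuousLinearMap.inverse_equiv e) a).symm
  rw [(key a).mlieBracket_vectorField_eq (key b)]
  have hc : ∀ a : 𝔼, MDifferentiableAt 𝓘(ℝ, 𝔼) (𝓘(ℝ, 𝔼).prod 𝓘(ℝ, 𝔼))
      (fun z : 𝔼 => (TotalSpace.mk' 𝔼 (E := fun x : 𝔼 ↦ TangentSpace 𝓘(ℝ, 𝔼) x) z a))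
      (extChartAt (𝓡 n) x₀ y) := fun a =>
    (contMDiffAt_vectorSpace_iff_contDiffAt (n := 1).2 contDiffAt_const).mdifferentiableAt
      one_ne_zero
  have : IsManifold (𝓡 n) (minSmoothness ℝ 2) M := by
    simp only [minSmoothness_of_isRCLikeNormedField]; infer_instance
  rw [← VectorField.mpullback_mlieBracket (hc a) (hc b) (contMDiffAt_extChartAt' (n := ∞) hy)
    (by simp only [minSmoothness_of_isRCLikeNormedField]; exact ENat.LEInfty.out)]
  have h0 : VectorField.mlieBracket 𝓘(ℝ, 𝔼) (fun _ : 𝔼 => a) (fun _ : 𝔼 => b)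
      (extChartAt (𝓡 n) x₀ y) = 0 := by
    have h1 := congrFun (VectorField.mlieBracketWithin_eq_lieBracketWithin (𝕜 := ℝ)
      (V := fun _ : 𝔼 => a) (W := fun _ : 𝔼 => b) (s := Set.univ)) (extChartAt (𝓡 n) x₀ y)
    have h2 : VectorField.lieBracketWithin ℝ (fun _ : 𝔼 => a) (fun _ : 𝔼 => b) Set.univ
        (extChartAt (𝓡 n) x₀ y) = 0 := by simp [VectorField.lieBracketWithin]
    exact (congrFun VectorField.mlieBracketWithin_univ _).symm.trans (h1.trans h2)
  rw [VectorField.mpullback_apply]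
  exact (congrArg _ h0).trans (map_zero _)

lemma christoffel_symm_of_torsionFree (D : AffineConnection n M) (hD : D.torsion = 0) {z : 𝔼}
    (hz : z ∈ (extChartAt (𝓡 n) x₀).target) (a b : 𝔼) :
    christoffel D x₀ z a b = christoffel D x₀ z b a := by
  have hy := extChartAt_symm_mem_source hz
  have h := (CovariantDerivative.torsion_eq_zero_iff D).1 hD
    (diffVectorFieldAt_ofCoord (w := fun _ => a) hy contMDiffAt_const)
    (diffVectorFieldAt_ofCoord (w := fun _ => b) hy contMDiffAt_const)
  rw [mlieBracket_ofCoord hy, christoffel_eq_target D hz, christoffel_eq_target D hz,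
    sub_eq_zero] at h
  exact ofCoord_injective hy h

end ManifoldMetric

/-! ### Projection and Lee field of a conformal product in a chart -/

section ConformalProduct

variable {n : ℕ} {M : Type*} [TopologicalSpace M]
  [ChartedSpace (EuclideanSpace ℝ (Fin n)) M] [IsManifold (𝓡 n) ∞ M] {x₀ : M}
  {g : SmoothMetric n M}

local notation "𝔼" => EuclideanSpace ℝ (Fin n)

/-- The coordinate isomorphism between a tangent space and the model space. -/
noncomputable def coordEquiv {y : M} (hy : y ∈ (chartAt 𝔼 x₀).source) :
    TangentSpace (𝓡 n) y ≃ₗ[ℝ] 𝔼 where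
  toFun := toCoord x₀ y
  invFun := ofCoord x₀ y
  map_add' := map_add _
  map_smul' := map_smul _
  left_inv := ofCoord_toCoord hy
  right_inv := toCoord_ofCoord hy

namespace ConformalProductStructure

variable (S : ConformalProductStructure g)

/-- The projection onto the first factor of a conformal product structure. -/
noncomputable def proj (y : M) : TangentSpace (𝓡 n) y →ₗ[ℝ] TangentSpace (𝓡 n) y :=
  Submodule.projection (S.T₁ y) (S.T₂ y) (S.isCompl y)

lemma proj_mem (y : M) (v : TangentSpace (𝓡 n) y) : S.proj y v ∈ S.T₁ y :=
  Submodule.projection_apply_mem _ v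

lemma sub_proj_mem (y : M) (v : TangentSpace (𝓡 n) y) : v - S.proj y v ∈ S.T₂ y := by
  have := Submodule.projection_add_projection_eq_self (S.isCompl y) v
  rw [proj]
  nth_rewrite 1 [← this]
  rw [add_sub_cancel_left]
  exact Submodule.projection_apply_mem _ v

lemma proj_eq_self {y : M} {v : TangentSpace (𝓡 n) y} (hv : v ∈ S.T₁ y) : S.proj y v = v :=
  (Submodule.projection_eq_self_iff (S.isCompl y) v).2 hv

lemma proj_eq_zero {y : M} {v : TangentSpace (𝓡 n) y} (hv : v ∈ S.T₂ y) : S.proj y v = 0 :=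
  (Submodule.projection_apply_eq_zero_iff (S.isCompl y)).2 hv

lemma inner_proj (y : M) (v w : TangentSpace (𝓡 n) y) :
    g.inner y (S.proj y v) w = g.inner y v (S.proj y w) := by
  have h1 := S.orthogonal y _ (S.proj_mem y v) _ (S.sub_proj_mem y w)
  have h2 := S.orthogonal y _ (S.proj_mem y w) _ (S.sub_proj_mem y v)
  rw [g.symm] at h2
  simp only [map_sub, sub_apply] at h1 h2
  linarith

/-- The projection onto the first factor in the chart centred at `x₀`. -/
noncomputable def chartProj (x₀ : M) (z : 𝔼) : 𝔼 →L[ℝ] 𝔼 :=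
  LinearMap.toContinuousLinearMap
    ((toCoord (n := n) x₀ ((extChartAt (𝓡 n) x₀).symm z)).toLinearMap ∘ₗ
      S.proj ((extChartAt (𝓡 n) x₀).symm z) ∘ₗ
        (ofCoord (n := n) x₀ ((extChartAt (𝓡 n) x₀).symm z)).toLinearMap)

lemma chartProj_apply (x₀ : M) (z a : 𝔼) : S.chartProj x₀ z a =
    toCoord x₀ ((extChartAt (𝓡 n) x₀).symm z) (S.proj _ (ofCoord x₀ _ a)) := rfl

lemma ofCoord_chartProj {z : 𝔼} (hz : z ∈ (extChartAt (𝓡 n) x₀).target) (a : 𝔼) :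
    ofCoord x₀ _ (S.chartProj x₀ z a) =
      S.proj ((extChartAt (𝓡 n) x₀).symm z) (ofCoord x₀ _ a) := by
  rw [chartProj_apply, ofCoord_toCoord (extChartAt_symm_mem_source hz)]

/-- Riesz representation at y, obtained by inverting the metric in the chart centred at y itself. -/
lemma exists_leeVector (y : M) :
    ∃ Θ : TangentSpace (𝓡 n) y, ∀ v, g.inner y Θ v = S.leeForm y v := by
  have hz : extChartAt (𝓡 n) y y ∈ (extChartAt (𝓡 n) y).target := mem_extChartAt_target y
  have hy : y ∈ (chartAt 𝔼 y).source := mem_chart_source 𝔼 y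
  have hb : (extChartAt (𝓡 n) y).symm (extChartAt (𝓡 n) y y) = y := extChartAt_symm_extChartAt hy
  refine ⟨ofCoord y y ((chartMetric g y (extChartAt (𝓡 n) y y)).inverse
    (S.leeForm y ∘L ofCoord y y)), fun v => ?_⟩
  have h := DFunLike.congr_fun (metric_inverse_apply (chartMetric_pos g hz)
    (S.leeForm y ∘L ofCoord y y)) (toCoord y y v)
  rw [chartMetric_apply, hb] at h
  rw [ofCoord_toCoord hy] at h
  rw [h]
  simp [ofCoord_toCoord hy]

/-- The vector field dual to the Lee form. -/
noncomputable def leeVector (y : M) : TangentSpace (𝓡 n) y := (S.exists_leeVector y).choose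

lemma inner_leeVector (y : M) (v : TangentSpace (𝓡 n) y) :
    g.inner y (S.leeVector y) v = S.leeForm y v := (S.exists_leeVector y).choose_spec v

/-- The Lee vector field in the chart centred at `x₀`. -/
noncomputable def chartLee (x₀ : M) (z : 𝔼) : 𝔼 :=
  toCoord x₀ ((extChartAt (𝓡 n) x₀).symm z) (S.leeVector _)

lemma chartMetric_chartLee {z : 𝔼} (hz : z ∈ (extChartAt (𝓡 n) x₀).target) (a : 𝔼) :
    chartMetric g x₀ z (S.chartLee x₀ z) a =
      S.leeForm ((extChartAt (𝓡 n) x₀).symm z) (ofCoord x₀ _ a) := by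
  rw [chartLee, chartMetric_apply, ofCoord_toCoord (extChartAt_symm_mem_source hz),
    inner_leeVector]

lemma contDiffAt_chartLee {z : 𝔼} (hz : z ∈ (extChartAt (𝓡 n) x₀).target) :
    ContDiffAt ℝ ∞ (S.chartLee x₀) z := by
  have hΩ := isOpen_extChartAt_target (I := 𝓡 n) x₀
  let f : 𝔼 → 𝔼 →L[ℝ] ℝ := fun z =>
    S.leeForm ((extChartAt (𝓡 n) x₀).symm z) ∘L ofCoord x₀ ((extChartAt (𝓡 n) x₀).symm z)
  have hf : ContDiffOn ℝ ∞ f (extChartAt (𝓡 n) x₀).target := by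
    rw [contDiffOn_clm_apply]
    intro a z hz
    refine ContDiffAt.contDiffWithinAt ?_
    have hy := extChartAt_symm_mem_source hz
    have h1 : ContMDiffAt (𝓡 n) ((𝓡 n).prod 𝓘(ℝ, ℝ)) ∞
        (fun y ↦ TotalSpace.mk' ℝ (E := Bundle.Trivial M ℝ) y
          (S.leeForm y (ofCoord x₀ y a))) ((extChartAt (𝓡 n) x₀).symm z) := by
      apply ContMDiffAt.clm_bundle_apply (F₁ := 𝔼)
      · exact S.isWeyl.leeForm_smooth _
      · exact contMDiffAt_ofCoord hy contMDiffAt_const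
    rw [contMDiffAt_section] at h1
    exact contDiffAt_comp_symm hz h1
  have h2 : ContDiffAt ℝ ∞ (fun z => (chartMetric g x₀ z).inverse (f z)) z :=
    (contDiffAt_metric_inverse (contDiffAt_chartMetric g hz) (chartMetric_pos g hz)).clm_apply
      (hf.contDiffAt (hΩ.mem_nhds hz))
  refine h2.congr_of_eventuallyEq ?_
  filter_upwards [hΩ.mem_nhds hz] with z hz
  refine metric_eq_of_forall (chartMetric_pos g hz) fun c => ?_
  rw [metric_inverse_apply (chartMetric_pos g hz), S.chartMetric_chartLee hz]
  rfl

/-- Local frames of T₁ and T₂ together form an invertible smooth matrix B. In that frame the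
projection is the constant map q keeping the T₁ coordinates, so P = B q B⁻¹, and inversion is
smooth. -/
lemma contDiffAt_chartProj {z : 𝔼} (hz : z ∈ (extChartAt (𝓡 n) x₀).target) :
    ContDiffAt ℝ ∞ (S.chartProj x₀) z := by
  have hΩ := isOpen_extChartAt_target (I := 𝓡 n) x₀
  have hy := extChartAt_symm_mem_source hz
  obtain ⟨U, hU, hyU, X, hX, hXT⟩ := S.isSmooth₁ ((extChartAt (𝓡 n) x₀).symm z)
  obtain ⟨U', hU', hyU', Y, hY, hYT⟩ := S.isSmooth₂ ((extChartAt (𝓡 n) x₀).symm z)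
  let Z : Fin S.corank ⊕ Fin S.rank → Π y : M, TangentSpace (𝓡 n) y := Sum.elim X Y
  let B : 𝔼 → (Fin S.corank ⊕ Fin S.rank → ℝ) →L[ℝ] 𝔼 := fun z =>
    ∑ s, (ContinuousLinearMap.proj (R := ℝ) s).smulRight
    (toCoord x₀ ((extChartAt (𝓡 n) x₀).symm z) (Z s _))
  let q : (Fin S.corank ⊕ Fin S.rank → ℝ) →L[ℝ] (Fin S.corank ⊕ Fin S.rank → ℝ) :=
    ContinuousLinearMap.pi
    (Sum.elim (fun i => ContinuousLinearMap.proj (R := ℝ) (Sum.inl i)) (fun _ => 0))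
  have hBs : ContDiffAt ℝ ∞ B z := by
    refine ContDiffAt.sum fun s _ => ContDiffAt.smulRight contDiffAt_const ?_
    refine contDiffAt_comp_symm (f := fun y => toCoord x₀ y (Z s y)) hz ?_
    rw [← contMDiffAt_section_iff_toCoord hy]
    rcases s with i | j
    · exact (hX i).contMDiffAt (hU.mem_nhds hyU)
    · exact (hY j).contMDiffAt (hU'.mem_nhds hyU')
  have hBa : ∀ z t, B z t = toCoord x₀ ((extChartAt (𝓡 n) x₀).symm z)
      (∑ i, t (Sum.inl i) • X i _ + ∑ j, t (Sum.inr j) • Y j _) := by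
    intro z t
    simp only [B, sum_apply, add_apply, ContinuousLinearMap.smulRight_apply, Fintype.sum_sum_type,
      Z, map_add, map_sum, map_smul]
    rfl
  have hequiv : ∀ w ∈ (extChartAt (𝓡 n) x₀).target, (extChartAt (𝓡 n) x₀).symm w ∈ U →
      (extChartAt (𝓡 n) x₀).symm w ∈ U' →
        ∃ e : (Fin S.corank ⊕ Fin S.rank → ℝ) ≃L[ℝ] 𝔼,
          (e : (Fin S.corank ⊕ Fin S.rank → ℝ) →L[ℝ] 𝔼) = B w := by
    intro w hw hwU hwU'
    have hyw := extChartAt_symm_mem_source hw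
    obtain ⟨hXi, hXs⟩ := hXT _ hwU
    obtain ⟨hYi, hYs⟩ := hYT _ hwU'
    have hbij : Function.Bijective (B w : (Fin S.corank ⊕ Fin S.rank → ℝ) →ₗ[ℝ] 𝔼) := by
      constructor
      · rw [injective_iff_map_eq_zero]
        intro t ht
        have ht' : B w t = 0 := ht
        rw [hBa] at ht'
        have h0 := toCoord_injective hyw (ht'.trans (map_zero _).symm)
        set v₁ := ∑ i, t (Sum.inl i) • X i ((extChartAt (𝓡 n) x₀).symm w) with hv₁
        set v₂ := ∑ j, t (Sum.inr j) • Y j ((extChartAt (𝓡 n) x₀).symm w) with hv₂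
        have m₁ : v₁ ∈ S.T₁ ((extChartAt (𝓡 n) x₀).symm w) := by
          rw [← hXs]
          exact Submodule.sum_mem _ fun i _ => Submodule.smul_mem _ _
            (Submodule.subset_span ⟨i, rfl⟩)
        have m₂ : v₂ ∈ S.T₂ ((extChartAt (𝓡 n) x₀).symm w) := by
          rw [← hYs]
          exact Submodule.sum_mem _ fun i _ => Submodule.smul_mem _ _
            (Submodule.subset_span ⟨i, rfl⟩)
        have e₁ : v₁ = 0 := by
          have h1 := congrArg (S.proj _) h0
          rwa [map_add, S.proj_eq_self m₁, S.proj_eq_zero m₂, add_zero, map_zero] at h1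
        have e₂ : v₂ = 0 := by rwa [e₁, zero_add] at h0
        funext s
        rcases s with i | j
        · exact Fintype.linearIndependent_iff.1 hXi (fun i => t (Sum.inl i)) e₁ i
        · exact Fintype.linearIndependent_iff.1 hYi (fun i => t (Sum.inr i)) e₂ j
      · intro a
        have m₁ := S.proj_mem _ (ofCoord x₀ ((extChartAt (𝓡 n) x₀).symm w) a)
        have m₂ := S.sub_proj_mem _ (ofCoord x₀ ((extChartAt (𝓡 n) x₀).symm w) a)
        rw [← hXs] at m₁
        rw [← hYs] at m₂
        obtain ⟨c, hc⟩ := (Submodule.mem_span_range_iff_exists_fun ℝ).1 m₁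
        obtain ⟨d, hd⟩ := (Submodule.mem_span_range_iff_exists_fun ℝ).1 m₂
        refine ⟨Sum.elim c d, ?_⟩
        change B w _ = a
        rw [hBa]
        simp only [Sum.elim_inl, Sum.elim_inr]
        rw [hc, hd, add_sub_cancel, toCoord_ofCoord hyw]
    refine ⟨(LinearEquiv.ofBijective _ hbij).toContinuousLinearEquiv, ?_⟩
    ext t
    rfl
  have hBinv : ContDiffAt ℝ ∞ (fun z => (B z).inverse) z := by
    obtain ⟨e, he⟩ := hequiv z hz hyU hyU'
    have h1 : ContDiffAt ℝ ∞ ContinuousLinearMap.inverse (B z) := by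
      rw [← he]; exact contDiffAt_map_inverse e
    exact h1.comp z hBs
  have hfin : ContDiffAt ℝ ∞ (fun z => B z ∘L q ∘L (B z).inverse) z :=
    hBs.clm_comp (contDiffAt_const.clm_comp hBinv)
  refine hfin.congr_of_eventuallyEq ?_
  have hcont : ContinuousAt (extChartAt (𝓡 n) x₀).symm z :=
    (continuousOn_extChartAt_symm x₀).continuousAt (hΩ.mem_nhds hz)
  filter_upwards [hΩ.mem_nhds hz, hcont (hU.mem_nhds hyU), hcont (hU'.mem_nhds hyU')] with
    w hw hwU hwU'
  obtain ⟨e, he⟩ := hequiv w hw hwU hwU'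
  have hyw := extChartAt_symm_mem_source hw
  ext1 a
  have ha : a = B w ((B w).inverse a) := by rw [← he]; simp
  set t := (B w).inverse a with ht
  rw [ContinuousLinearMap.comp_apply, ContinuousLinearMap.comp_apply, ← ht, ha, hBa, hBa,
    chartProj_apply, ofCoord_toCoord hyw]
  obtain ⟨hXi, hXs⟩ := hXT _ hwU
  obtain ⟨hYi, hYs⟩ := hYT _ hwU'
  congr 1
  rw [map_add, S.proj_eq_self, S.proj_eq_zero]
  · have h1 : ∀ i, q t (Sum.inl i) = t (Sum.inl i) := fun i => rfl
    have h2 : ∀ j, q t (Sum.inr j) = 0 := fun j => rfl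
    simp only [h1, h2, zero_smul, Finset.sum_const_zero]
  · rw [← hYs]
    exact Submodule.sum_mem _ fun i _ => Submodule.smul_mem _ _ (Submodule.subset_span ⟨i, rfl⟩)
  · rw [← hXs]
    exact Submodule.sum_mem _ fun i _ => Submodule.smul_mem _ _ (Submodule.subset_span ⟨i, rfl⟩)

lemma finrank_T₁ (y : M) : Module.finrank ℝ (S.T₁ y) = S.corank := by
  obtain ⟨U, hU, hyU, X, hX, hXT⟩ := S.isSmooth₁ y
  obtain ⟨hXi, hXs⟩ := hXT _ hyU
  rw [← hXs, finrank_span_eq_card hXi, Fintype.card_fin]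

lemma finrank_T₂ (y : M) : Module.finrank ℝ (S.T₂ y) = S.rank := by
  obtain ⟨U, hU, hyU, X, hX, hXT⟩ := S.isSmooth₂ y
  obtain ⟨hXi, hXs⟩ := hXT _ hyU
  rw [← hXs, finrank_span_eq_card hXi, Fintype.card_fin]

lemma finrank_range_chartProj {z : 𝔼} (hz : z ∈ (extChartAt (𝓡 n) x₀).target) :
    Module.finrank ℝ (LinearMap.range (S.chartProj x₀ z : 𝔼 →ₗ[ℝ] 𝔼)) = S.corank := by
  have hy := extChartAt_symm_mem_source hz
  suffices h : LinearMap.range (S.chartProj x₀ z : 𝔼 →ₗ[ℝ] 𝔼) =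
      Submodule.map (coordEquiv hy).toLinearMap (S.T₁ ((extChartAt (𝓡 n) x₀).symm z)) by
    rw [h, ← S.finrank_T₁ ((extChartAt (𝓡 n) x₀).symm z)]
    exact LinearEquiv.finrank_map_eq (coordEquiv hy) _
  ext a
  constructor
  · rintro ⟨b, rfl⟩
    exact ⟨_, S.proj_mem _ (ofCoord x₀ _ b), rfl⟩
  · rintro ⟨v, hv, rfl⟩
    refine ⟨toCoord x₀ _ v, ?_⟩
    change S.chartProj x₀ z _ = toCoord x₀ _ v
    rw [chartProj_apply, ofCoord_toCoord hy, S.proj_eq_self hv]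

lemma finrank_ker_chartProj {z : 𝔼} (hz : z ∈ (extChartAt (𝓡 n) x₀).target) :
    Module.finrank ℝ (LinearMap.ker (S.chartProj x₀ z : 𝔼 →ₗ[ℝ] 𝔼)) = S.rank := by
  have hy := extChartAt_symm_mem_source hz
  suffices h : LinearMap.ker (S.chartProj x₀ z : 𝔼 →ₗ[ℝ] 𝔼) =
      Submodule.map (coordEquiv hy).toLinearMap (S.T₂ ((extChartAt (𝓡 n) x₀).symm z)) by
    rw [h, ← S.finrank_T₂ ((extChartAt (𝓡 n) x₀).symm z)]
    exact LinearEquiv.finrank_map_eq (coordEquiv hy) _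
  ext a
  constructor
  · intro ha
    have ha' : S.chartProj x₀ z a = 0 := ha
    rw [chartProj_apply] at ha'
    have h1 := toCoord_injective hy (ha'.trans (map_zero _).symm)
    refine ⟨ofCoord x₀ _ a, ?_, toCoord_ofCoord hy a⟩
    have h2 := S.sub_proj_mem _ (ofCoord x₀ ((extChartAt (𝓡 n) x₀).symm z) a)
    rwa [h1, sub_zero] at h2
  · rintro ⟨v, hv, rfl⟩
    change S.chartProj x₀ z (toCoord x₀ _ v) = 0
    rw [chartProj_apply, ofCoord_toCoord hy, S.proj_eq_zero hv, map_zero]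

end ConformalProductStructure

end ConformalProduct

/-! ### The Kähler structure in a chart and assembly of the chart data -/

section KahlerChart

variable {n : ℕ} {M : Type*} [TopologicalSpace M]
  [ChartedSpace (EuclideanSpace ℝ (Fin n)) M] [IsManifold (𝓡 n) ∞ M] {x₀ : M}
  {g : SmoothMetric n M}

local notation "𝔼" => EuclideanSpace ℝ (Fin n)

/-- A field of endomorphisms in the chart centred at `x₀`. -/
noncomputable def chartEndo (J : Π x : M, TangentSpace (𝓡 n) x →L[ℝ] TangentSpace (𝓡 n) x)
    (x₀ : M) (z : 𝔼) : 𝔼 →L[ℝ] 𝔼 :=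
  toCoord x₀ ((extChartAt (𝓡 n) x₀).symm z) ∘L J ((extChartAt (𝓡 n) x₀).symm z) ∘L
    ofCoord x₀ ((extChartAt (𝓡 n) x₀).symm z)

lemma chartEndo_apply (J : Π x : M, TangentSpace (𝓡 n) x →L[ℝ] TangentSpace (𝓡 n) x)
    (x₀ : M) (z a : 𝔼) : chartEndo J x₀ z a =
      toCoord x₀ ((extChartAt (𝓡 n) x₀).symm z) (J _ (ofCoord x₀ _ a)) := rfl

lemma ofCoord_chartEndo (J : Π x : M, TangentSpace (𝓡 n) x →L[ℝ] TangentSpace (𝓡 n) x) {z : 𝔼}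
    (hz : z ∈ (extChartAt (𝓡 n) x₀).target) (a : 𝔼) :
    ofCoord x₀ _ (chartEndo J x₀ z a) = J ((extChartAt (𝓡 n) x₀).symm z) (ofCoord x₀ _ a) := by
  rw [chartEndo_apply, ofCoord_toCoord (extChartAt_symm_mem_source hz)]

lemma contDiffAt_chartEndo {J : Π x : M, TangentSpace (𝓡 n) x →L[ℝ] TangentSpace (𝓡 n) x}
    (hJ : ContMDiff (𝓡 n)
      ((𝓡 n).prod 𝓘(ℝ, EuclideanSpace ℝ (Fin n) →L[ℝ] EuclideanSpace ℝ (Fin n))) ∞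
      (fun x ↦ TotalSpace.mk' (EuclideanSpace ℝ (Fin n) →L[ℝ] EuclideanSpace ℝ (Fin n))
        (E := fun x : M ↦ TangentSpace (𝓡 n) x →L[ℝ] TangentSpace (𝓡 n) x) x (J x))) {z : 𝔼}
    (hz : z ∈ (extChartAt (𝓡 n) x₀).target) : ContDiffAt ℝ ∞ (chartEndo J x₀) z := by
  have hΩ := isOpen_extChartAt_target (I := 𝓡 n) x₀
  suffices h : ContDiffOn ℝ ∞ (chartEndo J x₀) (extChartAt (𝓡 n) x₀).target from
    h.contDiffAt (hΩ.mem_nhds hz)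
  rw [contDiffOn_clm_apply]
  intro a z hz
  refine ContDiffAt.contDiffWithinAt ?_
  have hy := extChartAt_symm_mem_source hz
  have h1 : ContMDiffAt (𝓡 n) ((𝓡 n).prod 𝓘(ℝ, 𝔼)) ∞
      (fun y ↦ TotalSpace.mk' 𝔼 (E := fun x : M ↦ TangentSpace (𝓡 n) x) y
        (J y (ofCoord x₀ y a))) ((extChartAt (𝓡 n) x₀).symm z) := by
    apply ContMDiffAt.clm_bundle_apply (F₁ := 𝔼)
    · exact hJ _
    · exact contMDiffAt_ofCoord hy contMDiffAt_const
  rw [contMDiffAt_section_iff_toCoord hy] at h1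
  exact contDiffAt_comp_symm hz h1

/-- Covariant derivatives of `L (∂_a)` for a field `L` of endomorphisms, in coordinates. -/
lemma connection_ofCoord_endo (D : AffineConnection n M) {L : 𝔼 → 𝔼 →L[ℝ] 𝔼} {z : 𝔼}
    (hz : z ∈ (extChartAt (𝓡 n) x₀).target) (hL : ContDiffAt ℝ ∞ L z) (v a : 𝔼) :
    DiffVectorFieldAt (fun y => ofCoord x₀ y (L (extChartAt (𝓡 n) x₀ y) a))
        ((extChartAt (𝓡 n) x₀).symm z) ∧
    D (fun y => ofCoord x₀ y (L (extChartAt (𝓡 n) x₀ y) a)) ((extChartAt (𝓡 n) x₀).symm z)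
        (ofCoord x₀ _ v) =
      ofCoord x₀ _ (fderiv ℝ L z v a + christoffel D x₀ z v (L z a)) := by
  have hy := extChartAt_symm_mem_source hz
  have hz' := (extChartAt (𝓡 n) x₀).right_inv hz
  have hw : ContDiffAt ℝ ∞ (fun z => L z a) (extChartAt (𝓡 n) x₀
      ((extChartAt (𝓡 n) x₀).symm z)) := by
    rw [hz']; exact hL.clm_apply contDiffAt_const
  refine ⟨diffVectorFieldAt_ofCoord hy (contMDiffAt_comp_extChartAt hy hw), ?_⟩
  rw [connection_apply_ofCoord D hy hw, toCoord_ofCoord hy, hz']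
  have h1 : HasFDerivAt (fun z => L z a) _ z :=
    (hL.differentiableAt (by simp)).hasFDerivAt.clm_apply (hasFDerivAt_const a z)
  rw [h1.fderiv]
  simp

lemma fderiv_chartEndo_of_parallel
    {J : Π x : M, TangentSpace (𝓡 n) x →L[ℝ] TangentSpace (𝓡 n) x} {D : AffineConnection n M}
    (hJ : ∀ z ∈ (extChartAt (𝓡 n) x₀).target, ContDiffAt ℝ ∞ (chartEndo J x₀) z)
    (hD : ∀ (x : M) (Y : Π y : M, TangentSpace (𝓡 n) y), DiffVectorFieldAt Y x →
      ∀ v : TangentSpace (𝓡 n) x, D (fun y ↦ J y (Y y)) x v = J x (D Y x v)) {z : 𝔼}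
    (hz : z ∈ (extChartAt (𝓡 n) x₀).target) (v a : 𝔼) :
    fderiv ℝ (chartEndo J x₀) z v a =
      chartEndo J x₀ z (christoffel D x₀ z v a) - christoffel D x₀ z v (chartEndo J x₀ z a) := by
  have hy := extChartAt_symm_mem_source hz
  obtain ⟨hd, h1⟩ := connection_ofCoord_endo D hz (hJ z hz) v a
  have hc := diffVectorFieldAt_ofCoord (w := fun _ => a) hy contMDiffAt_const
  have h2 := hD _ _ hc (ofCoord x₀ _ v)
  have hev : (fun y => ofCoord x₀ y (chartEndo J x₀ (extChartAt (𝓡 n) x₀ y) a)) =ᶠ[𝓝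
      ((extChartAt (𝓡 n) x₀).symm z)] fun y => J y (ofCoord x₀ y a) := by
    filter_upwards [source_mem_nhds hy] with y hy
    rw [chartEndo_apply, extChartAt_symm_extChartAt hy, ofCoord_toCoord hy]
  rw [christoffel_eq_target D hz, ← ofCoord_chartEndo J hz] at h2
  have hd' : DiffVectorFieldAt (fun y => J y (ofCoord x₀ y a)) ((extChartAt (𝓡 n) x₀).symm z) := by
    refine MDifferentiableAt.congr_of_eventuallyEq hd ?_
    filter_upwards [hev] with y hy
    rw [hy]
  rw [D.isCovariantDerivativeOnUniv.congr_of_eventuallyEq hd hd' Filter.univ_mem hev, h2] at h1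
  have h3 := ofCoord_injective hy h1
  rw [h3, add_sub_cancel_right]

namespace ConformalProductStructure

variable (S : ConformalProductStructure g)

lemma chartProj_idem {z : 𝔼} (hz : z ∈ (extChartAt (𝓡 n) x₀).target) (a : 𝔼) :
    S.chartProj x₀ z (S.chartProj x₀ z a) = S.chartProj x₀ z a := by
  rw [chartProj_apply, S.ofCoord_chartProj hz, S.proj_eq_self (S.proj_mem _ _), chartProj_apply]

/-- D-parallelism of T₁ is applied to the sections P∂_a, and that of T₂ to (1 - P)∂_a. The first
says that D(P∂_a) is fixed by P, the second that D((1 - P)∂_a) is killed by P; together they give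
D(P∂_a) = P D∂_a. -/
lemma fderiv_chartProj {z : 𝔼} (hz : z ∈ (extChartAt (𝓡 n) x₀).target) (v a : 𝔼) :
    fderiv ℝ (S.chartProj x₀) z v a = S.chartProj x₀ z (christoffel S.D x₀ z v a) -
      christoffel S.D x₀ z v (S.chartProj x₀ z a) := by
  have hy := extChartAt_symm_mem_source hz
  have hP := S.contDiffAt_chartProj hz
  have key : ∀ y ∈ (chartAt 𝔼 x₀).source, ofCoord x₀ y (S.chartProj x₀ (extChartAt (𝓡 n) x₀ y) a) =
      S.proj y (ofCoord x₀ y a) := by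
    intro y hy
    rw [chartProj_apply, extChartAt_symm_extChartAt hy, ofCoord_toCoord hy]
  obtain ⟨hd₁, h₁⟩ := connection_ofCoord_endo S.D hz hP v a
  obtain ⟨hd₂, h₂⟩ := connection_ofCoord_endo S.D
    (L := fun z => ContinuousLinearMap.id ℝ 𝔼 - S.chartProj x₀ z) hz (contDiffAt_const.sub hP) v a
  have m₁ := S.parallel₁ _ _ hd₁ (by
    filter_upwards [source_mem_nhds hy] with y hy
    rw [key y hy]
    exact S.proj_mem _ _) (ofCoord x₀ _ v)
  have m₂ := S.parallel₂ _ _ hd₂ (by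
    filter_upwards [source_mem_nhds hy] with y hy
    rw [sub_apply, map_sub, key y hy]
    exact S.sub_proj_mem _ _) (ofCoord x₀ _ v)
  rw [h₁] at m₁
  rw [h₂] at m₂
  have e₁ := S.proj_eq_self m₁
  have e₂ := S.proj_eq_zero m₂
  rw [← S.ofCoord_chartProj hz] at e₁ e₂
  have f₁ := ofCoord_injective hy e₁
  have f₂ := ofCoord_injective hy (e₂.trans (map_zero _).symm)
  rw [fderiv_const_sub] at f₂
  simp only [map_add, map_sub, neg_apply, sub_apply, map_neg, ContinuousLinearMap.id_apply] at f₁ f₂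
  rw [neg_add_eq_zero, eq_sub_iff_add_eq] at f₂
  rw [eq_sub_iff_add_eq, ← f₁, f₂]

/-- Both connections are torsion-free and differentiate the same metric, so their difference is
fixed by the Lee form. -/
lemma christoffel_eq_add_weylTensor {D : AffineConnection n M} (hD : IsLeviCivita g D) {z : 𝔼}
    (hz : z ∈ (extChartAt (𝓡 n) x₀).target) :
    christoffel S.D x₀ z =
      christoffel D x₀ z + weylTensor (chartMetric g x₀ z) (S.chartLee x₀ z) := by
  refine weyl_christoffel_unique (chartMetric_symm g x₀ z) (chartMetric_pos g hz)
    (christoffel_symm_of_torsionFree D hD.torsionFree hz)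
    (christoffel_symm_of_torsionFree S.D S.isWeyl.torsionFree hz) _ fun v a b => ?_
  have h1 := fderiv_chartMetric_of_weyl g S.D S.leeForm S.isWeyl.derivMetric hz v a b
  have h2 := fderiv_chartMetric_of_weyl g D (fun _ => 0)
    (fun x Y Z hY hZ v => by rw [hD.derivMetric x Y Z hY hZ v]; simp) hz v a b
  rw [S.chartMetric_chartLee hz]
  simp only [zero_apply, mul_zero, zero_mul, sub_zero] at h2
  linarith

/-- A conformal product structure on a Kähler manifold in the chart centred at `x₀`. -/
lemma isConformalKahlerChart
    {J : Π x : M, TangentSpace (𝓡 n) x →L[ℝ] TangentSpace (𝓡 n) x} (hJ : IsKahler g J)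
    {D : AffineConnection n M} (hD : IsLeviCivita g D)
    (hDJ : ∀ (x : M) (Y : Π y : M, TangentSpace (𝓡 n) y), DiffVectorFieldAt Y x →
      ∀ v : TangentSpace (𝓡 n) x, D (fun y ↦ J y (Y y)) x v = J x (D Y x v)) (x₀ : M) :
    IsConformalKahlerChart (extChartAt (𝓡 n) x₀).target (chartMetric g x₀) (christoffel D x₀)
      (chartEndo J x₀) (S.chartProj x₀) (S.chartLee x₀) S.corank S.rank := by
  have hΩ := isOpen_extChartAt_target (I := 𝓡 n) x₀
  have hG : ∀ z ∈ (extChartAt (𝓡 n) x₀).target, ContDiffAt ℝ ∞ (chartMetric g x₀) z :=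
    fun z hz => contDiffAt_chartMetric g hz
  have hdG : ∀ z ∈ (extChartAt (𝓡 n) x₀).target, ∀ v a b : 𝔼,
      fderiv ℝ (chartMetric g x₀) z v a b = chartMetric g x₀ z (christoffel D x₀ z v a) b +
        chartMetric g x₀ z a (christoffel D x₀ z v b) := by
    intro z hz v a b
    have h2 := fderiv_chartMetric_of_weyl g D (fun _ => 0)
      (fun x Y Z hY hZ v => by rw [hD.derivMetric x Y Z hY hZ v]; simp) hz v a b
    simpa only [zero_apply, mul_zero, zero_mul, sub_zero] using h2
  have hΓ : ∀ z ∈ (extChartAt (𝓡 n) x₀).target, ∀ a b : 𝔼,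
      christoffel D x₀ z a b = christoffel D x₀ z b a :=
    fun z hz => christoffel_symm_of_torsionFree D hD.torsionFree hz
  have hJs : ∀ z ∈ (extChartAt (𝓡 n) x₀).target, ContDiffAt ℝ ∞ (chartEndo J x₀) z :=
    fun z hz => contDiffAt_chartEndo hJ.smooth hz
  exact
    { isOpen := hΩ
      contDiffAt_metric := hG
      contDiffAt_christoffel := fun z hz => contDiffAt_christoffel_of_metric hΩ hG
        (fun z _ => chartMetric_symm g x₀ z) (fun z hz => chartMetric_pos g hz) hΓ hdG hz
      contDiffAt_complex := hJs
      contDiffAt_proj := fun z hz => S.contDiffAt_chartProj hz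
      contDiffAt_lee := fun z hz => S.contDiffAt_chartLee hz
      metric_symm := fun z _ => chartMetric_symm g x₀ z
      metric_pos := fun z hz => chartMetric_pos g hz
      christoffel_symm := hΓ
      fderiv_metric := hdG
      complex_sq := fun z hz a => by
        have hy := extChartAt_symm_mem_source hz
        rw [chartEndo_apply, ofCoord_chartEndo J hz, hJ.sq, map_neg, toCoord_ofCoord hy]
      complex_orthogonal := fun z hz a b => by
        rw [chartMetric_apply, ofCoord_chartEndo J hz, ofCoord_chartEndo J hz, hJ.orthogonal,
          chartMetric_apply]
      fderiv_complex := fun z hz => fderiv_chartEndo_of_parallel hJs hDJ hz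
      proj_idem := fun z hz => S.chartProj_idem hz
      proj_symm := fun z hz a b => by
        rw [chartMetric_apply, S.ofCoord_chartProj hz, S.inner_proj, chartMetric_apply,
          S.ofCoord_chartProj hz]
      fderiv_proj := fun z hz v a => by
        rw [← S.christoffel_eq_add_weylTensor hD hz, S.fderiv_chartProj hz]
      finrank_range := fun z hz => S.finrank_range_chartProj hz
      finrank_ker := fun z hz => S.finrank_ker_chartProj hz }

end ConformalProductStructure

end KahlerChart

/-! ### Integration in charts and the local divergence theorem -/

section DivergenceTheorem

open MeasureTheory

variable {n : ℕ} {M : Type*} [TopologicalSpace M]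
  [ChartedSpace (EuclideanSpace ℝ (Fin n)) M] {x₀ x₁ : M}

local notation "𝔼" => EuclideanSpace ℝ (Fin n)

lemma continuousAt_of_comp_symm {X : Type*} [TopologicalSpace X] {f : M → X} {y : M}
    (hy : y ∈ (chartAt 𝔼 x₀).source)
    (hf : ContinuousAt (fun z => f ((extChartAt (𝓡 n) x₀).symm z)) (extChartAt (𝓡 n) x₀ y)) :
    ContinuousAt f y := by
  have h1 : ContinuousAt (fun y => f ((extChartAt (𝓡 n) x₀).symm (extChartAt (𝓡 n) x₀ y))) y :=
    ContinuousAt.comp (f := extChartAt (𝓡 n) x₀) hf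
      (continuousAt_extChartAt' (by rwa [extChartAt_source]))
  refine h1.congr ?_
  filter_upwards [source_mem_nhds hy] with y hy
  rw [extChartAt_symm_extChartAt hy]

lemma continuousOn_comp_symm {X : Type*} [TopologicalSpace X] {f : M → X} (hf : Continuous f) :
    ContinuousOn (fun z => f ((extChartAt (𝓡 n) x₀).symm z)) (extChartAt (𝓡 n) x₀).target :=
  hf.comp_continuousOn (continuousOn_extChartAt_symm x₀)

/-- The image in a chart of the support of a function supported in that chart. -/
lemma isCompact_extChartAt_image_tsupport [CompactSpace M] {f : M → ℝ}
    (hf : tsupport f ⊆ (chartAt 𝔼 x₀).source) :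
    IsCompact (extChartAt (𝓡 n) x₀ '' tsupport f) :=
  (isClosed_tsupport f).isCompact.image_of_continuousOn
    ((continuousOn_extChartAt x₀).mono (by rwa [extChartAt_source]))

lemma extChartAt_image_tsupport_subset {f : M → ℝ}
    (hf : tsupport f ⊆ (chartAt 𝔼 x₀).source) :
    extChartAt (𝓡 n) x₀ '' tsupport f ⊆ (extChartAt (𝓡 n) x₀).target := by
  rintro _ ⟨y, hy, rfl⟩
  exact (extChartAt (𝓡 n) x₀).map_source (by rw [extChartAt_source]; exact hf hy)

lemma eq_zero_of_notMem_image_tsupport {f : M → ℝ} {z : 𝔼}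
    (hz : z ∈ (extChartAt (𝓡 n) x₀).target) (hz' : z ∉ extChartAt (𝓡 n) x₀ '' tsupport f) :
    f ((extChartAt (𝓡 n) x₀).symm z) = 0 := by
  by_contra h
  exact hz' ⟨_, subset_tsupport f h, (extChartAt (𝓡 n) x₀).right_inv hz⟩

lemma measurableSet_extChartAt_target (x₀ : M) : MeasurableSet (extChartAt (𝓡 n) x₀).target :=
  (isOpen_extChartAt_target x₀).measurableSet

lemma tsupport_mvfderiv_apply_subset (χ : M → ℝ) (V : Π y : M, TangentSpace (𝓡 n) y) :
    tsupport (fun y => mvfderiv (𝓡 n) χ y (V y)) ⊆ tsupport χ := by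
  refine closure_minimal (fun y hy => ?_) (isClosed_tsupport χ)
  by_contra hn
  apply hy
  have h1 : χ =ᶠ[𝓝 y] fun _ => 0 := notMem_tsupport_iff_eventuallyEq.1 hn
  simp only
  rw [mvfderiv_congr h1]
  simp [mvfderiv]

variable [IsManifold (𝓡 n) ∞ M]

/-- The derivative of a coordinate change. -/
lemma hasFDerivAt_extChartAt_comp_symm {z : 𝔼} (hz : z ∈ (extChartAt (𝓡 n) x₀).target)
    (hy : (extChartAt (𝓡 n) x₀).symm z ∈ (chartAt 𝔼 x₁).source) :
    HasFDerivAt (fun z => extChartAt (𝓡 n) x₁ ((extChartAt (𝓡 n) x₀).symm z))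
      (toCoord x₁ ((extChartAt (𝓡 n) x₀).symm z) ∘L
        ofCoord x₀ ((extChartAt (𝓡 n) x₀).symm z)) z := by
  have hy₀ := extChartAt_symm_mem_source hz
  have hz' := (extChartAt (𝓡 n) x₀).right_inv hz
  have h1 : HasMFDerivAt (𝓡 n) 𝓘(ℝ, 𝔼) (extChartAt (𝓡 n) x₁) ((extChartAt (𝓡 n) x₀).symm z)
      (toCoord x₁ ((extChartAt (𝓡 n) x₀).symm z)) := by
    rw [toCoord_eq_mfderiv hy]
    exact (mdifferentiableAt_extChartAt hy).hasMFDerivAt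
  have h2 : HasMFDerivAt 𝓘(ℝ, 𝔼) (𝓡 n) (extChartAt (𝓡 n) x₀).symm z
      (ofCoord x₀ ((extChartAt (𝓡 n) x₀).symm z)) := by
    have h3 : ContMDiffAt 𝓘(ℝ, 𝔼) (𝓡 n) ∞ (extChartAt (𝓡 n) x₀).symm z :=
      (contMDiffOn_extChartAt_symm x₀).contMDiffAt ((isOpen_extChartAt_target x₀).mem_nhds hz)
    have h4 := TangentBundle.symmL_trivializationAt (I := 𝓡 n) hy₀
    rw [hz'] at h4
    have h5 := (h3.mdifferentiableAt (by simp)).hasMFDerivAt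
    rw [ofCoord, h4]
    simpa [mfderivWithin_univ] using h5
  exact (h1.comp z h2).hasFDerivAt

lemma chartMetric_eq_bilinearComp (g : SmoothMetric n M) {z : 𝔼}
    (hy : (extChartAt (𝓡 n) x₀).symm z ∈ (chartAt 𝔼 x₁).source) :
    chartMetric g x₀ z =
      (chartMetric g x₁ (extChartAt (𝓡 n) x₁ ((extChartAt (𝓡 n) x₀).symm z))).bilinearComp
        (toCoord x₁ ((extChartAt (𝓡 n) x₀).symm z) ∘L ofCoord x₀ ((extChartAt (𝓡 n) x₀).symm z))
        (toCoord x₁ ((extChartAt (𝓡 n) x₀).symm z) ∘L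
          ofCoord x₀ ((extChartAt (𝓡 n) x₀).symm z)) := by
  ext1 a
  ext1 b
  rw [ContinuousLinearMap.bilinearComp_apply, chartMetric_apply, chartMetric_apply,
    extChartAt_symm_extChartAt hy]
  simp only [ContinuousLinearMap.comp_apply, ofCoord_toCoord hy]

/-- The integral of `h` over the domain of the chart centred at `x₀`, with respect to the
Riemannian density. -/
noncomputable def chartIntegral (g : SmoothMetric n M) (x₀ : M) (h : M → ℝ) : ℝ :=
  ∫ z in (extChartAt (𝓡 n) x₀).target,
    h ((extChartAt (𝓡 n) x₀).symm z) * metricDensity (chartMetric g x₀ z)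

lemma continuousOn_chartDensity (g : SmoothMetric n M) (x₀ : M) :
    ContinuousOn (fun z => metricDensity (chartMetric g x₀ z)) (extChartAt (𝓡 n) x₀).target :=
  fun _ hz => (contDiffAt_metricDensity (contDiffAt_chartMetric g hz) (chartMetric_symm g x₀ _)
    (chartMetric_pos g hz)).continuousAt.continuousWithinAt

/-- Integrals of functions supported in two charts can be computed in either of them. -/
lemma chartIntegral_eq_of_support_subset (g : SmoothMetric n M) {h : M → ℝ}
    (h₀ : Function.support h ⊆ (chartAt 𝔼 x₀).source)
    (h₁ : Function.support h ⊆ (chartAt 𝔼 x₁).source) :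
    chartIntegral g x₀ h = chartIntegral g x₁ h := by
  -- The image in chart a of the overlap with chart b. Both integrals reduce to it, and the density
  -- transforms by the absolute Jacobian determinant, as the change of variables requires.
  set T : M → M → Set 𝔼 := fun a b =>
    (extChartAt (𝓡 n) a).target ∩ (extChartAt (𝓡 n) a).symm ⁻¹' (chartAt 𝔼 b).source with hT
  have key : ∀ a b : M, Function.support h ⊆ (chartAt 𝔼 b).source → chartIntegral g a h =
      ∫ z in T a b, h ((extChartAt (𝓡 n) a).symm z) * metricDensity (chartMetric g a z) := by
    intro a b hb
    refine setIntegral_eq_of_subset_of_forall_sdiff_eq_zero (measurableSet_extChartAt_target a)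
      Set.inter_subset_left fun z hz => ?_
    have : h ((extChartAt (𝓡 n) a).symm z) = 0 := by
      by_contra hne
      exact hz.2 ⟨hz.1, hb hne⟩
    rw [this, zero_mul]
  have hTo : ∀ a b : M, IsOpen (T a b) := fun a b =>
    (continuousOn_extChartAt_symm a).isOpen_inter_preimage (isOpen_extChartAt_target a)
      (chartAt 𝔼 b).open_source
  have himage : (fun z => extChartAt (𝓡 n) x₁ ((extChartAt (𝓡 n) x₀).symm z)) '' T x₀ x₁ =
      T x₁ x₀ := by
    ext w
    constructor
    · rintro ⟨z, ⟨hz, hz'⟩, rfl⟩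
      refine ⟨(extChartAt (𝓡 n) x₁).map_source (by rw [extChartAt_source]; exact hz'), ?_⟩
      rw [Set.mem_preimage, extChartAt_symm_extChartAt hz']
      exact extChartAt_symm_mem_source hz
    · rintro ⟨hw, hw'⟩
      refine ⟨extChartAt (𝓡 n) x₀ ((extChartAt (𝓡 n) x₁).symm w), ⟨?_, ?_⟩, ?_⟩
      · exact (extChartAt (𝓡 n) x₀).map_source (by rw [extChartAt_source]; exact hw')
      · rw [Set.mem_preimage, extChartAt_symm_extChartAt hw']
        exact extChartAt_symm_mem_source hw
      · simp only
        rw [extChartAt_symm_extChartAt hw', (extChartAt (𝓡 n) x₁).right_inv hw]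
  have hinj : Set.InjOn (fun z => extChartAt (𝓡 n) x₁ ((extChartAt (𝓡 n) x₀).symm z))
      (T x₀ x₁) := by
    intro z hz w hw hzw
    have h1 := (extChartAt (𝓡 n) x₁).injOn (by rw [extChartAt_source]; exact hz.2)
      (by rw [extChartAt_source]; exact hw.2) hzw
    exact (extChartAt (𝓡 n) x₀).symm.injOn hz.1 hw.1 h1
  rw [key x₀ x₁ h₁, key x₁ x₀ h₀, ← himage,
    integral_image_eq_integral_abs_det_fderiv_smul volume (hTo x₀ x₁).measurableSet
      (fun z hz => (hasFDerivAt_extChartAt_comp_symm hz.1 hz.2).hasFDerivWithinAt) hinj]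
  refine setIntegral_congr_fun (hTo x₀ x₁).measurableSet fun z hz => ?_
  simp only
  rw [extChartAt_symm_extChartAt hz.2, chartMetric_eq_bilinearComp g hz.2, metricDensity_comp,
    smul_eq_mul]
  ring

lemma integrableOn_chart [CompactSpace M] (g : SmoothMetric n M) {h : M → ℝ} (hc : Continuous h)
    (hs : tsupport h ⊆ (chartAt 𝔼 x₀).source) :
    IntegrableOn (fun z => h ((extChartAt (𝓡 n) x₀).symm z) * metricDensity (chartMetric g x₀ z))
      (extChartAt (𝓡 n) x₀).target := by
  have hK := isCompact_extChartAt_image_tsupport hs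
  have h1 : IntegrableOn (fun z => h ((extChartAt (𝓡 n) x₀).symm z) *
      metricDensity (chartMetric g x₀ z)) (extChartAt (𝓡 n) x₀ '' tsupport h) :=
    (((continuousOn_comp_symm hc).mul (continuousOn_chartDensity g x₀)).mono
      (extChartAt_image_tsupport_subset hs)).integrableOn_compact hK
  refine h1.of_forall_sdiff_eq_zero (measurableSet_extChartAt_target x₀) fun z hz => ?_
  rw [eq_zero_of_notMem_image_tsupport hz.1 hz.2, zero_mul]

lemma chartIntegral_finset_sum [CompactSpace M] (g : SmoothMetric n M) {ι : Type*} (s : Finset ι)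
    {h : ι → M → ℝ} (hc : ∀ i, Continuous (h i))
    (hs : ∀ i, tsupport (h i) ⊆ (chartAt 𝔼 x₀).source) :
    chartIntegral g x₀ (fun y => ∑ i ∈ s, h i y) = ∑ i ∈ s, chartIntegral g x₀ (h i) := by
  simp only [chartIntegral, Finset.sum_mul]
  exact integral_finsetSum _ fun i _ => integrableOn_chart g (hc i) (hs i)

lemma chartIntegral_add [CompactSpace M] (g : SmoothMetric n M) {h k : M → ℝ} (hc : Continuous h)
    (kc : Continuous k) (hs : tsupport h ⊆ (chartAt 𝔼 x₀).source)
    (ks : tsupport k ⊆ (chartAt 𝔼 x₀).source) :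
    chartIntegral g x₀ (fun y => h y + k y) = chartIntegral g x₀ h + chartIntegral g x₀ k := by
  simp only [chartIntegral, add_mul]
  exact integral_add (integrableOn_chart g hc hs) (integrableOn_chart g kc ks)

lemma chartIntegral_nonneg (g : SmoothMetric n M) {h : M → ℝ} (hh : ∀ y, 0 ≤ h y) :
    0 ≤ chartIntegral g x₀ h :=
  integral_nonneg fun _ => mul_nonneg (hh _) (Real.sqrt_nonneg _)

/-- A nonnegative integrand with zero integral vanishes almost everywhere, hence everywhere on the
open chart target by continuity; the density is positive and can be divided out. -/
lemma eq_zero_of_chartIntegral_eq_zero [CompactSpace M] (g : SmoothMetric n M) {h : M → ℝ}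
    (hc : Continuous h) (hs : tsupport h ⊆ (chartAt 𝔼 x₀).source) (hh : ∀ y, 0 ≤ h y)
    (h0 : chartIntegral g x₀ h = 0) {y : M} (hy : y ∈ (chartAt 𝔼 x₀).source) : h y = 0 := by
  have h1 := (setIntegral_eq_zero_iff_of_nonneg_ae
    (Filter.Eventually.of_forall fun z => mul_nonneg (hh _) (Real.sqrt_nonneg _))
    (integrableOn_chart g hc hs)).1 h0
  have h2 := Measure.eqOn_open_of_ae_eq h1 (isOpen_extChartAt_target x₀)
    ((continuousOn_comp_symm hc).mul (continuousOn_chartDensity g x₀)) continuousOn_const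
  have hz : extChartAt (𝓡 n) x₀ y ∈ (extChartAt (𝓡 n) x₀).target :=
    (extChartAt (𝓡 n) x₀).map_source (by rwa [extChartAt_source])
  have h3 := h2 hz
  simp only [Pi.zero_apply] at h3
  rw [extChartAt_symm_extChartAt hy] at h3
  exact (mul_eq_zero.1 h3).resolve_right
    (metricDensity_pos (chartMetric_symm g x₀ _) (chartMetric_pos g hz)).ne'

/-- A vector field in the chart centred at `x₀`. -/
noncomputable def chartField (V : Π y : M, TangentSpace (𝓡 n) y) (x₀ : M) (z : 𝔼) : 𝔼 :=
  toCoord x₀ ((extChartAt (𝓡 n) x₀).symm z) (V _)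

lemma fderiv_comp_symm {χ : M → ℝ} (hχ : ContMDiff (𝓡 n) 𝓘(ℝ, ℝ) ∞ χ)
    (V : Π y : M, TangentSpace (𝓡 n) y) {z : 𝔼} (hz : z ∈ (extChartAt (𝓡 n) x₀).target) :
    mvfderiv (𝓡 n) χ ((extChartAt (𝓡 n) x₀).symm z) (V _) =
      fderiv ℝ (fun z => χ ((extChartAt (𝓡 n) x₀).symm z)) z (chartField V x₀ z) := by
  have hy := extChartAt_symm_mem_source hz
  have hz' := (extChartAt (𝓡 n) x₀).right_inv hz
  have hev : χ =ᶠ[𝓝 ((extChartAt (𝓡 n) x₀).symm z)]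
      fun y => (fun z => χ ((extChartAt (𝓡 n) x₀).symm z)) (extChartAt (𝓡 n) x₀ y) := by
    filter_upwards [source_mem_nhds hy] with y hy
    rw [extChartAt_symm_extChartAt hy]
  rw [mvfderiv_congr hev, mvfderiv_comp_extChartAt
    (f := fun z => χ ((extChartAt (𝓡 n) x₀).symm z)) hy
    (by rw [hz']; exact (contDiffAt_comp_symm hz (hχ _)).differentiableAt (by simp)), hz']
  rfl

lemma continuous_mvfderiv_apply {χ : M → ℝ} (hχ : ContMDiff (𝓡 n) 𝓘(ℝ, ℝ) ∞ χ)
    {V : Π y : M, TangentSpace (𝓡 n) y}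
    (hV : ∀ x₀ : M, ∀ z ∈ (extChartAt (𝓡 n) x₀).target, ContDiffAt ℝ ∞ (chartField V x₀) z) :
    Continuous fun y => mvfderiv (𝓡 n) χ y (V y) := by
  rw [continuous_iff_continuousAt]
  intro x₀
  have hz := mem_extChartAt_target (I := 𝓡 n) x₀
  refine continuousAt_of_comp_symm (mem_chart_source 𝔼 x₀) ?_
  have h1 : ContinuousAt (fun z => fderiv ℝ (fun z => χ ((extChartAt (𝓡 n) x₀).symm z)) z
      (chartField V x₀ z)) (extChartAt (𝓡 n) x₀ x₀) :=
    (((contDiffAt_comp_symm hz (hχ _)).fderiv_right (m := 0) (by simp)).continuousAt).clm_apply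
      (hV x₀ _ hz).continuousAt
  refine h1.congr ?_
  filter_upwards [(isOpen_extChartAt_target x₀).mem_nhds hz] with z hz
  rw [fderiv_comp_symm hχ V hz]

/-- The divergence theorem for vector fields supported in a chart. -/
lemma chartIntegral_divergence_eq_zero [CompactSpace M] {g : SmoothMetric n M}
    {D : AffineConnection n M} (hD : IsLeviCivita g D) {χ : M → ℝ}
    (hχ : ContMDiff (𝓡 n) 𝓘(ℝ, ℝ) ∞ χ) (hs : tsupport χ ⊆ (chartAt 𝔼 x₀).source)
    {V : Π y : M, TangentSpace (𝓡 n) y} {q : M → ℝ}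
    (hV : ∀ z ∈ (extChartAt (𝓡 n) x₀).target, ContDiffAt ℝ ∞ (chartField V x₀) z)
    (hq : ∀ z ∈ (extChartAt (𝓡 n) x₀).target,
      christoffelDiv (christoffel D x₀) (chartField V x₀) z = q ((extChartAt (𝓡 n) x₀).symm z)) :
    chartIntegral g x₀ (fun y => χ y * q y + mvfderiv (𝓡 n) χ y (V y)) = 0 := by
  classical
  have hΩ := isOpen_extChartAt_target (I := 𝓡 n) x₀
  set K := extChartAt (𝓡 n) x₀ '' tsupport χ with hKdef
  have hK : IsCompact K := isCompact_extChartAt_image_tsupport hs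
  have hKΩ : K ⊆ (extChartAt (𝓡 n) x₀).target := extChartAt_image_tsupport_subset hs
  set w : 𝔼 → 𝔼 := fun z => (χ ((extChartAt (𝓡 n) x₀).symm z) *
    metricDensity (chartMetric g x₀ z)) • chartField V x₀ z with hw
  -- Extension by zero. It stays smooth because the image K of the support of χ is compact and
  -- contained in the open chart target.
  set W : 𝔼 → 𝔼 := (extChartAt (𝓡 n) x₀).target.indicator w with hWdef
  have hWw : ∀ z ∈ (extChartAt (𝓡 n) x₀).target, W =ᶠ[𝓝 z] w := fun z hz => by
    filter_upwards [hΩ.mem_nhds hz] with y hy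
    exact Set.indicator_of_mem hy _
  have hW0 : ∀ z ∉ K, W z = 0 := by
    intro z hz
    by_cases hzt : z ∈ (extChartAt (𝓡 n) x₀).target
    · rw [hWdef, Set.indicator_of_mem hzt, hw]
      simp only
      rw [eq_zero_of_notMem_image_tsupport hzt hz, zero_mul, zero_smul]
    · exact Set.indicator_of_notMem hzt _
  have hWev : ∀ z ∉ (extChartAt (𝓡 n) x₀).target, W =ᶠ[𝓝 z] fun _ => 0 := fun z hz => by
    filter_upwards [hK.isClosed.isOpen_compl.mem_nhds fun h => hz (hKΩ h)] with y hy
    exact hW0 y hy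
  have hWs : ContDiff ℝ 1 W := by
    rw [contDiff_iff_contDiffAt]
    intro z
    by_cases hz : z ∈ (extChartAt (𝓡 n) x₀).target
    · refine ContDiffAt.congr_of_eventuallyEq ?_ (hWw z hz)
      refine ContDiffAt.of_le ?_ (n := ∞) ENat.LEInfty.out
      exact ((contDiffAt_comp_symm hz (hχ _)).mul (contDiffAt_metricDensity
        (contDiffAt_chartMetric g hz) (chartMetric_symm g x₀ _) (chartMetric_pos g hz))).smul
        (hV z hz)
    · exact contDiffAt_const.congr_of_eventuallyEq (hWev z hz)
  have hWc : HasCompactSupport W := HasCompactSupport.intro hK hW0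
  have h1 := integral_trace_fderiv_eq_zero hWs hWc
  rw [← setIntegral_eq_integral_of_forall_compl_eq_zero (s := (extChartAt (𝓡 n) x₀).target)
    (fun z hz => by rw [(hWev z hz).fderiv_eq]; simp)] at h1
  rw [← h1, chartIntegral]
  refine setIntegral_congr_fun hΩ.measurableSet fun z hz => ?_
  have hdG : ∀ v a b : 𝔼, fderiv ℝ (chartMetric g x₀) z v a b =
      chartMetric g x₀ z (christoffel D x₀ z v a) b +
        chartMetric g x₀ z a (christoffel D x₀ z v b) := by
    intro v a b
    have h2 := fderiv_chartMetric_of_weyl g D (fun _ => 0)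
      (fun x Y Z hY hZ v => by rw [hD.derivMetric x Y Z hY hZ v]; simp) hz v a b
    simpa only [zero_apply, mul_zero, zero_mul, sub_zero] using h2
  rw [(hWw z hz).fderiv_eq, hw, trace_fderiv_smul_eq (Γ := christoffel D x₀)
    (contDiffAt_chartMetric g hz) (chartMetric_symm g x₀ _) (chartMetric_pos g hz) hdG
    (christoffel_symm_of_torsionFree D hD.torsionFree hz) ((hV z hz).differentiableAt (by simp))
    ((contDiffAt_comp_symm hz (hχ _)).differentiableAt (by simp)), hq z hz,
    fderiv_comp_symm hχ V hz]

end DivergenceTheorem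

/-! ### Global divergence argument and proof of the theorem -/

section Conclusion

variable {n : ℕ} {M : Type*} [TopologicalSpace M]
  [ChartedSpace (EuclideanSpace ℝ (Fin n)) M]

local notation "𝔼" => EuclideanSpace ℝ (Fin n)

lemma mvfderiv_finset_sum {ι : Type*} (s : Finset ι) {f : ι → M → ℝ}
    (hf : ∀ i, ContMDiff (𝓡 n) 𝓘(ℝ, ℝ) ∞ (f i)) (y : M) :
    mvfderiv (𝓡 n) (fun y => ∑ i ∈ s, f i y) y = ∑ i ∈ s, mvfderiv (𝓡 n) (f i) y := by
  classical
  induction s using Finset.induction_on with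
  | empty =>
    simp only [Finset.sum_empty]
    ext v
    simp [mvfderiv]
  | insert i s hi ih =>
    simp only [Finset.sum_insert hi]
    rw [mvfderiv_fun_add ((hf i y).mdifferentiableAt (by simp))
      ((contMDiff_finsetSum (fun i _ => hf i) y).mdifferentiableAt (by simp)), ih]

variable [IsManifold (𝓡 n) ∞ M]

lemma exists_finite_smoothPartitionOfUnity [T2Space M] [CompactSpace M] :
    ∃ (t : Finset M) (f : t → M → ℝ), (∀ i, ContMDiff (𝓡 n) 𝓘(ℝ, ℝ) ∞ (f i)) ∧
      (∀ i y, 0 ≤ f i y) ∧ (∀ y, ∑ i, f i y = 1) ∧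
      ∀ i, tsupport (f i) ⊆ (chartAt 𝔼 (i : M)).source := by
  obtain ⟨t, ht⟩ := CompactSpace.elim_nhds_subcover (fun x : M => (chartAt 𝔼 x).source)
    fun x => chart_source_mem_nhds 𝔼 x
  obtain ⟨f, hf⟩ := SmoothPartitionOfUnity.exists_isSubordinate (𝓡 n) (isClosed_univ (X := M))
    (fun i : t => (chartAt 𝔼 (i : M)).source) (fun i => (chartAt 𝔼 (i : M)).open_source)
    (fun y _ => by
      have : y ∈ ⋃ x ∈ t, (chartAt 𝔼 x).source := by rw [ht]; trivial
      simpa using this)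
  refine ⟨t, fun i => f i, fun i => (f i).contMDiff, f.nonneg, fun y => ?_, hf⟩
  rw [← finsum_eq_sum_of_fintype]
  exact f.sum_eq_one (Set.mem_univ y)

/-- On a compact Riemannian manifold a nonpositive divergence vanishes. -/
theorem eq_zero_of_divergence_nonpos [T2Space M] [CompactSpace M] {g : SmoothMetric n M}
    {D : AffineConnection n M} (hD : IsLeviCivita g D) {V : Π y : M, TangentSpace (𝓡 n) y}
    {q : M → ℝ} (hq : Continuous q) (hq0 : ∀ y, q y ≤ 0)
    (hV : ∀ x₀ : M, ∀ z ∈ (extChartAt (𝓡 n) x₀).target, ContDiffAt ℝ ∞ (chartField V x₀) z)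
    (hdiv : ∀ x₀ : M, ∀ z ∈ (extChartAt (𝓡 n) x₀).target,
      christoffelDiv (christoffel D x₀) (chartField V x₀) z = q ((extChartAt (𝓡 n) x₀).symm z))
    (y : M) : q y = 0 := by
  obtain ⟨t, f, hf, hf0, hf1, hfs⟩ := exists_finite_smoothPartitionOfUnity (n := n) (M := M)
  have hfc : ∀ i, Continuous (f i) := fun i => (hf i).continuous
  set d : t → M → ℝ := fun i y => mvfderiv (𝓡 n) (f i) y (V y) with hd
  have hdc : ∀ i, Continuous (d i) := fun i => continuous_mvfderiv_apply (hf i) hV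
  have hds : ∀ i, tsupport (d i) ⊆ tsupport (f i) := fun i =>
    tsupport_mvfderiv_apply_subset (f i) V
  have hd0 : ∀ y, ∑ i, d i y = 0 := by
    intro y
    have h1 : mvfderiv (𝓡 n) (fun y => ∑ i, f i y) y (V y) = ∑ i, d i y := by
      rw [mvfderiv_finset_sum _ hf, sum_apply]
    rw [← h1]
    simp only [hf1]
    simp [mvfderiv]
  have hstep : ∀ i : t, chartIntegral g (i : M) (fun y => f i y * q y) +
      chartIntegral g (i : M) (d i) = 0 := by
    intro i
    rw [← chartIntegral_add g (h := fun y => f i y * q y) ((hfc i).mul hq) (hdc i)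
      ((tsupport_mul_subset_left).trans (hfs i)) ((hds i).trans (hfs i))]
    exact chartIntegral_divergence_eq_zero hD (hf i) (hfs i) (hV i) (hdiv i)
  -- The functions dfᵢ(V) sum to zero but are integrated in different charts. Inserting ∑ fⱼ = 1 and
  -- moving fⱼ dfᵢ(V) to chart j, which also contains its support, puts the sum over i inside one
  -- integral.
  have hswap : ∑ i : t, chartIntegral g (i : M) (d i) = 0 := by
    have h1 : ∀ i : t, chartIntegral g (i : M) (d i) =
        ∑ j : t, chartIntegral g (j : M) (fun y => f j y * d i y) := by
      intro i
      have h2 : d i = fun y => ∑ j, f j y * d i y := by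
        funext y
        rw [← Finset.sum_mul, hf1, one_mul]
      conv_lhs => rw [h2]
      rw [chartIntegral_finset_sum g _ (h := fun j y => f j y * d i y)
        (fun j => (hfc j).mul (hdc i))
        (fun j => (tsupport_mul_subset_right).trans ((hds i).trans (hfs i)))]
      refine Finset.sum_congr rfl fun j _ => chartIntegral_eq_of_support_subset g ?_ ?_
      · exact (subset_tsupport _).trans
          ((tsupport_mul_subset_right).trans ((hds i).trans (hfs i)))
      · exact (subset_tsupport _).trans ((tsupport_mul_subset_left).trans (hfs j))
    simp only [h1]
    rw [Finset.sum_comm]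
    refine Finset.sum_eq_zero fun j _ => ?_
    rw [← chartIntegral_finset_sum g _ (h := fun i y => f j y * d i y)
        (fun i => (hfc j).mul (hdc i))
        (fun i => (tsupport_mul_subset_left).trans (hfs j))]
    simp only [← Finset.mul_sum, hd0, mul_zero, chartIntegral, zero_mul,
      MeasureTheory.integral_zero]
  have hnn : ∀ i, ∀ y, 0 ≤ -(f i y * q y) := fun i y => by
    have := mul_nonneg (hf0 i y) (neg_nonneg.2 (hq0 y))
    linarith
  have hneg : ∀ i : t, chartIntegral g (i : M) (fun y => -(f i y * q y)) =
      chartIntegral g (i : M) (d i) := by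
    intro i
    have h1 : chartIntegral g (i : M) (fun y => -(f i y * q y)) =
        - chartIntegral g (i : M) (fun y => f i y * q y) := by
      simp only [chartIntegral, neg_mul]
      exact MeasureTheory.integral_neg _
    linarith [hstep i]
  -- Here q ≤ 0 enters: nonnegative integrals whose sum is zero all vanish.
  have hall : ∀ i : t, chartIntegral g (i : M) (fun y => -(f i y * q y)) = 0 := by
    have h1 : ∑ i : t, chartIntegral g (i : M) (fun y => -(f i y * q y)) = 0 := by
      simp only [hneg, hswap]
    intro i
    exact (Finset.sum_eq_zero_iff_of_nonneg
      (fun i _ => chartIntegral_nonneg g (hnn i))).1 h1 i (Finset.mem_univ i)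
  have hex : ∃ i, f i y ≠ 0 := by
    by_contra! h
    have := hf1 y
    simp [h] at this
  obtain ⟨i, hi⟩ := hex
  have hsub : tsupport (fun y => -(f i y * q y)) ⊆ (chartAt 𝔼 (i : M)).source := by
    have h1 : (fun y => -(f i y * q y)) = fun y => f i y * -q y := by funext y; ring
    rw [h1]
    exact (tsupport_mul_subset_left).trans (hfs i)
  have h2 := eq_zero_of_chartIntegral_eq_zero g ((hfc i).mul hq).neg hsub (hnn i) (hall i)
    (hfs i (subset_tsupport _ hi))
  exact (mul_eq_zero.1 (neg_eq_zero.1 h2)).resolve_left hi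

namespace ConformalProductStructure

variable {g : SmoothMetric n M} (S : ConformalProductStructure g)

/-- The combination of the components of the Lee field whose divergence has a sign. -/
noncomputable def leeCombination (y : M) : TangentSpace (𝓡 n) y :=
  (S.corank : ℝ) • (S.leeVector y - S.proj y (S.leeVector y)) +
    (S.rank : ℝ) • S.proj y (S.leeVector y)

/-- The divergence of `leeCombination`. -/
noncomputable def leeDivergence (y : M) : ℝ :=
  -((S.rank * (S.rank - 1) : ℝ) *
      g.inner y (S.proj y (S.leeVector y)) (S.proj y (S.leeVector y)) +
    (S.corank * (S.corank - 1) : ℝ) * g.inner y (S.leeVector y - S.proj y (S.leeVector y))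
      (S.leeVector y - S.proj y (S.leeVector y)))

lemma chartProj_chartLee {x₀ : M} {z : 𝔼} (hz : z ∈ (extChartAt (𝓡 n) x₀).target) :
    S.chartProj x₀ z (S.chartLee x₀ z) =
      toCoord x₀ ((extChartAt (𝓡 n) x₀).symm z) (S.proj _ (S.leeVector _)) := by
  rw [chartProj_apply, chartLee, ofCoord_toCoord (extChartAt_symm_mem_source hz)]

lemma chartField_leeCombination {x₀ : M} {z : 𝔼} (hz : z ∈ (extChartAt (𝓡 n) x₀).target) :
    chartField S.leeCombination x₀ z =
      IsConformalKahlerChart.leeCombination (S.chartProj x₀) (S.chartLee x₀) S.corank S.rank z := by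
  rw [IsConformalKahlerChart.leeCombination, S.chartProj_chartLee hz]
  rw [chartField, leeCombination, map_add, map_smul, map_smul, map_sub, chartLee]

lemma leeDivergence_symm {x₀ : M} {z : 𝔼} (hz : z ∈ (extChartAt (𝓡 n) x₀).target) :
    S.leeDivergence ((extChartAt (𝓡 n) x₀).symm z) =
      -((S.rank * (S.rank - 1) : ℝ) * chartMetric g x₀ z (S.chartProj x₀ z (S.chartLee x₀ z))
          (S.chartProj x₀ z (S.chartLee x₀ z)) +
        (S.corank * (S.corank - 1) : ℝ) * chartMetric g x₀ z
          (S.chartLee x₀ z - S.chartProj x₀ z (S.chartLee x₀ z))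
          (S.chartLee x₀ z - S.chartProj x₀ z (S.chartLee x₀ z))) := by
  rw [S.chartProj_chartLee hz, chartLee, ← map_sub, chartMetric_toCoord g hz,
    chartMetric_toCoord g hz, leeDivergence]

lemma continuous_leeDivergence : Continuous S.leeDivergence := by
  rw [continuous_iff_continuousAt]
  intro x₀
  have hz := mem_extChartAt_target (I := 𝓡 n) x₀
  refine continuousAt_of_comp_symm (mem_chart_source 𝔼 x₀) ?_
  have hG := (contDiffAt_chartMetric g hz).continuousAt
  have hL := (S.contDiffAt_chartLee hz).continuousAt
  have hP := (S.contDiffAt_chartProj hz).continuousAt.clm_apply hL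
  have h1 := ((continuousAt_const (y := (S.rank * (S.rank - 1) : ℝ))).mul
    ((hG.clm_apply hP).clm_apply hP)).add ((continuousAt_const
      (y := (S.corank * (S.corank - 1) : ℝ))).mul
    ((hG.clm_apply (hL.sub hP)).clm_apply (hL.sub hP)))
  refine h1.neg.congr ?_
  filter_upwards [(isOpen_extChartAt_target x₀).mem_nhds hz] with z hz
  exact (S.leeDivergence_symm hz).symm

lemma inner_self_nonneg (y : M) (v : TangentSpace (𝓡 n) y) : 0 ≤ g.inner y v v := by
  rcases eq_or_ne v 0 with rfl | hv
  · simp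
  · exact (g.pos y v hv).le

/-- With both ranks at least 2 the coefficients n(n-1) are strictly positive, so both components of
the Lee field vanish. For rank 1 the coefficient of the T₁-component would be zero. -/
lemma leeForm_eq_zero_of_leeDivergence_eq_zero (h₁ : 2 ≤ S.corank) (h₂ : 2 ≤ S.rank) {y : M}
    (h : S.leeDivergence y = 0) : S.leeForm y = 0 := by
  have hr : (0 : ℝ) < S.rank * (S.rank - 1) := by
    have : (2 : ℝ) ≤ S.rank := by exact_mod_cast h₂
    nlinarith
  have hc : (0 : ℝ) < S.corank * (S.corank - 1) := by
    have : (2 : ℝ) ≤ S.corank := by exact_mod_cast h₁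
    nlinarith
  have n₁ := inner_self_nonneg (g := g) y (S.proj y (S.leeVector y))
  have n₂ := inner_self_nonneg (g := g) y (S.leeVector y - S.proj y (S.leeVector y))
  rw [leeDivergence, neg_eq_zero, add_eq_zero_iff_of_nonneg (mul_nonneg hr.le n₁)
    (mul_nonneg hc.le n₂)] at h
  have e₁ : S.proj y (S.leeVector y) = 0 := by
    by_contra hne
    exact (g.pos y _ hne).ne' ((mul_eq_zero.1 h.1).resolve_left hr.ne')
  have e₂ : S.leeVector y - S.proj y (S.leeVector y) = 0 := by
    by_contra hne
    exact (g.pos y _ hne).ne' ((mul_eq_zero.1 h.2).resolve_left hc.ne')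
  rw [e₁, sub_zero] at e₂
  ext v
  rw [← S.inner_leeVector, e₂]
  simp

end ConformalProductStructure

end Conclusion

theorem theorem4p1 {n : ℕ} {M : Type*} [TopologicalSpace M] [T2Space M] [CompactSpace M]
    [ChartedSpace (EuclideanSpace ℝ (Fin n)) M] [IsManifold (𝓡 n) ∞ M]
    (g : SmoothMetric n M)
    (J : Π x : M, TangentSpace (𝓡 n) x →L[ℝ] TangentSpace (𝓡 n) x)
    (hJ : IsKahler g J)
    (P : ConformalProductStructure g)
    (hθ : ∃ x : M, P.leeForm x ≠ 0) :
    P.rank = 1 := by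
  by_contra hne
  have h₂ : 2 ≤ P.rank := by have := P.one_le_rank; omega
  have h₁ : 2 ≤ P.corank := h₂.trans P.rank_le_corank
  obtain ⟨D, hD, hDJ⟩ := hJ.parallel
  obtain ⟨x, hx⟩ := hθ
  -- It suffices that the nonpositive function `leeDivergence` vanishes, and it does so as the
  -- divergence of a smooth field on a compact manifold.
  refine hx (P.leeForm_eq_zero_of_leeDivergence_eq_zero h₁ h₂ ?_)
  have hchart := P.isConformalKahlerChart hJ hD hDJ
  have hev : ∀ x₀ : M, ∀ z ∈ (extChartAt (𝓡 n) x₀).target,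
      chartField P.leeCombination x₀ =ᶠ[𝓝 z] IsConformalKahlerChart.leeCombination
        (P.chartProj x₀) (P.chartLee x₀) P.corank P.rank := by
    intro x₀ z hz
    filter_upwards [(isOpen_extChartAt_target x₀).mem_nhds hz] with z hz
    exact P.chartField_leeCombination hz
  refine eq_zero_of_divergence_nonpos (V := P.leeCombination) hD P.continuous_leeDivergence ?_
    (fun x₀ z hz => ?_) (fun x₀ z hz => ?_) x
  · intro y
    have hr : (0 : ℝ) ≤ P.rank * (P.rank - 1) := by
      have : (2 : ℝ) ≤ P.rank := by exact_mod_cast h₂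
      nlinarith
    have hc : (0 : ℝ) ≤ P.corank * (P.corank - 1) := by
      have : (2 : ℝ) ≤ P.corank := by exact_mod_cast h₁
      nlinarith
    rw [ConformalProductStructure.leeDivergence, neg_nonpos]
    exact add_nonneg (mul_nonneg hr (ConformalProductStructure.inner_self_nonneg y _))
      (mul_nonneg hc (ConformalProductStructure.inner_self_nonneg y _))
  · refine ContDiffAt.congr_of_eventuallyEq ?_ (hev x₀ z hz)
    have hL := P.contDiffAt_chartLee hz
    have hP := (P.contDiffAt_chartProj hz).clm_apply hL
    exact ((hL.sub hP).const_smul (P.corank : ℝ)).add (hP.const_smul (P.rank : ℝ))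
  · rw [P.leeDivergence_symm hz, ← (hchart x₀).christoffelDiv_leeCombination h₁ h₂ hz,
      christoffelDiv, christoffelDiv, (hev x₀ z hz).fderiv_eq, (hev x₀ z hz).eq_of_nhds]
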